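/- Let $P, Q \in \mathbf{C}[x,y]$ with $J(P,Q) = P_xQ_y - P_yQ_x$ equal to a nonzero constant, let $\deg P = Kd$ and $\deg Q = Ke$ (total degrees) with $\gcd(d,e)=1$, and let $P$ and $Q$ be monic in $y$ up to constants, i.e. $P = Ay^{Kd} + \dots + a_1(x)y + a_0(x)$ and $Q = By^{Ke} + \dots + b_1(x)y + b_0(x)$ with constants $A \neq 0$, $B \neq 0$. Let $A_f \subset \mathbf{C}^2_{(u,v)}$ be the non-proper value set of $f = (P,Q) : \mathbf{C}^2 \to \mathbf{C}^2$, i.e. the set of all $a \in \mathbf{C}^2$ such that $f^{-1}(N)$ is not compact for any compact neighbourhood $N$ of $a$. If $A_f \neq \emptyset$, then $A_f$ is a plane algebraic curve (the zero set of a nonconstant polynomial), its closure in $\mathbf{CP}^2$ meets the line at infinity in exactly one point, and every irreducible branch at infinity of $A_f$ has a Newton–Puiseux expansion of the form $$u = c\,v^{d/e} + \text{lower terms in } v \quad\text{with}\quad c^e = A^e/B^d .$$ Here an irreducible branch at infinity is one that is parametrized by an injective map $t \mapsto (u(t),v(t)) \in A_f$ on a small punctured disc about $0$ that is meromorphic at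 $0$ and tends to infinity as $t \to 0$; and the expansion means that $v = \tau^{-m}$ and $u = \sum_{k\ge 0} c_k \tau^{k-n}$ (convergent) for some local holomorphic coordinate $\tau$ at $t=0$ with $\tau(0)=0$, some integers $m\ge 1$ and $n$ with $n/m = d/e$, and $c_0 = c$. -/

import Mathlib

open Filter Topology
open scoped LinearAlgebra.Projectivization

/-- The polynomial map `f = (P, Q) : ℂ² → ℂ²`; the variables `x, y` are indexed by `0, 1`. -/
noncomputable def polyMap (P Q : MvPolynomial (Fin 2) ℂ) (z : Fin 2 → ℂ) : Fin 2 → ℂ :=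
  ![MvPolynomial.eval z P, MvPolynomial.eval z Q]

/-- The Jacobian determinant `J(P, Q) = P_x Q_y - P_y Q_x`. -/
noncomputable def jacobianDet (P Q : MvPolynomial (Fin 2) ℂ) : MvPolynomial (Fin 2) ℂ :=
  MvPolynomial.pderiv 0 P * MvPolynomial.pderiv 1 Q -
    MvPolynomial.pderiv 1 P * MvPolynomial.pderiv 0 Q

/-- The non-proper value set of `f`: the points `a` such that no compact neighbourhood of `a`
has a compact preimage. -/
def nonProperValueSet (f : (Fin 2 → ℂ) → (Fin 2 → ℂ)) : Set (Fin 2 → ℂ) :=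
  {a | ∀ N ∈ 𝓝 a, IsCompact N → ¬ IsCompact (f ⁻¹' N)}

/-- An affine algebraic plane curve: the zero set of a nonconstant polynomial. -/
def IsPlaneCurve (S : Set (Fin 2 → ℂ)) : Prop :=
  ∃ R : MvPolynomial (Fin 2) ℂ, R.totalDegree ≠ 0 ∧ S = {a | MvPolynomial.eval a R = 0}

/-- The complex projective plane. -/
abbrev ComplexProjectivePlane : Type := ℙ ℂ (Fin 3 → ℂ)

/-- The usual topology of the complex projective plane, as a quotient of `ℂ³ ∖ {0}`. -/
instance : TopologicalSpace ComplexProjectivePlane :=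
  inferInstanceAs
    (TopologicalSpace (Quotient (projectivizationSetoid ℂ (Fin 3 → ℂ))))

/-- The standard affine chart `(u, v) ↦ [1 : u : v]`. -/
noncomputable def affineChart (a : Fin 2 → ℂ) : ComplexProjectivePlane :=
  Projectivization.mk ℂ ![1, a 0, a 1] (fun h => one_ne_zero (congrFun h 0))

/-- The points at infinity of `S`: the points of its closure in the projective plane that lie on
the line at infinity, i.e. outside the affine chart. -/
def pointsAtInfinity (S : Set (Fin 2 → ℂ)) : Set ComplexProjectivePlane :=
  closure (affineChart '' S) \ Set.range affineChart

/-- `γ` parametrizes an irreducible branch at infinity of `S`: near the puncture of a small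
punctured disc about `0` it is meromorphic, injective, has values in `S`, and it goes to infinity
at the puncture. -/
def IsBranchAtInfinity (S : Set (Fin 2 → ℂ)) (γ : ℂ → Fin 2 → ℂ) : Prop :=
  (∀ i, MeromorphicAt (fun t => γ t i) 0) ∧
  (∀ᶠ t in 𝓝[≠] (0 : ℂ), γ t ∈ S) ∧
  (∃ D ∈ 𝓝[≠] (0 : ℂ), Set.InjOn γ D) ∧
  Tendsto γ (𝓝[≠] (0 : ℂ)) (cocompact (Fin 2 → ℂ))

/-- The branch `γ` has the (convergent) Newton–Puiseux expansion at infinity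
`u = a₀ v^(n/m) + a₁ v^((n-1)/m) + a₂ v^((n-2)/m) + ⋯`: for some local coordinate `τ` at `0`
one has `v = τ^(-m)`, so that `τ⁻¹` is a determination of `v^(1/m)`, and
`u = ∑ k, a_k (τ⁻¹)^(n-k)`. -/
def HasNewtonPuiseuxExpansion (γ : ℂ → Fin 2 → ℂ) (m : ℕ) (n : ℤ) (a : ℕ → ℂ) : Prop :=
  0 < m ∧ ∃ τ : ℂ → ℂ, AnalyticAt ℂ τ 0 ∧ τ 0 = 0 ∧ deriv τ 0 ≠ 0 ∧
    ∀ᶠ t in 𝓝[≠] (0 : ℂ),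
      γ t 1 = ((τ t)⁻¹) ^ m ∧
      HasSum (fun k : ℕ => a k * ((τ t)⁻¹) ^ (n - (k : ℤ))) (γ t 0)

/-! Put `x = t⁻¹` and work over the Hahn series in `t` with rational exponents, an algebraically
closed field. Apart from finitely many exceptions, each non-proper value is the limit of `(P, Q)`
along an arc `y = φ(t)`. Expand about such an arc and rescale: `P(t⁻¹, φ + ξ t^s) = p(ξ) t^w + ⋯`
and `Q(t⁻¹, φ + ξ t^s) = q(ξ) t^w' + ⋯`. Since the Jacobian is constant, so is `w p q' - w' p' q`
(`initialForm_wronskian`).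

For very negative `s` the forms are `A ξ^(Kd)` and `B ξ^(Ke)`. Let `s` grow. While the weights are
negative, `p` and `q` have no constant term, because `P` and `Q` have no pole along the arc; hence
the Wronskian vanishes and `p^e / q^d` is constant. Its value stays `A^e / B^d`, being handed on
through the vertices that consecutive initial forms share. So the two Newton polygons remain similar
until both weights reach zero at the same `s = r` (`exists_similarAtInfinity`). There `ξ ↦ (p(ξ),
q(ξ))` is a polynomial curve through the limit with `u^e / v^d → A^e / B^d` at infinity. Moving the
arc by terms of order at least `r` only translates `ξ`, and the ball of radius `r` contains a root
of `P(t⁻¹, Y)`, so finitely many curves suffice (`exists_finite_curves`).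

The arcs come from the resultant of `P - u` and `Q - v` in `y`, a polynomial in `x`: its leading
coefficient cuts out the non-proper value set (`nonProperValueSet_eq`), and a drop of its degree
produces an arc (`exists_arc`). Hence `u^e / v^d → A^e / B^d` at infinity on that set
(`tendsto_ratio`). This single limit determines both the point at infinity and the leading term of
every branch. -/

section

open Polynomial

/-! ### Hahn series with rational exponents -/

namespace HahnSeries

/-- The ring homomorphism between rings of Hahn series that acts on the coefficients. -/
noncomputable def coeffRingHom {R S : Type*} [CommRing R] [CommRing S] (f : R →+* S) :
    HahnSeries ℚ R →+* HahnSeries ℚ S where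
  toFun x := x.map f
  map_one' := HahnSeries.map_one f.toMonoidWithZeroHom
  map_mul' _ _ := HahnSeries.map_mul (f : R →ₙ+* S)
  map_zero' := HahnSeries.map_zero (f : ZeroHom R S)
  map_add' _ _ := HahnSeries.map_add (f : R →+ S)

@[simp]
theorem coeff_coeffRingHom {R S : Type*} [CommRing R] [CommRing S] (f : R →+* S)
    (x : HahnSeries ℚ R) (q : ℚ) : (coeffRingHom f x).coeff q = f (x.coeff q) := rfl

@[simp]
theorem coeffRingHom_single {R S : Type*} [CommRing R] [CommRing S] (f : R →+* S)
    (a : ℚ) (r : R) : coeffRingHom f (single a r) = single a (f r) :=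
  HahnSeries.map_single (f : ZeroHom R S)

/-- The Euler operator `t d/dt`, which multiplies the coefficient of `t ^ q` by `q`. -/
noncomputable def euler (R : Type*) [CommRing R] [Algebra ℂ R] :
    HahnSeries ℚ R →+ HahnSeries ℚ R where
  toFun x :=
    { coeff := fun q => (q : ℂ) • x.coeff q
      isPWO_support' := x.isPWO_support.mono fun q hq h => hq (by simp [h]) }
  map_zero' := by ext q; simp
  map_add' x y := by ext q; simp

@[simp]
theorem coeff_euler {R : Type*} [CommRing R] [Algebra ℂ R] (x : HahnSeries ℚ R)
    (q : ℚ) : (euler R x).coeff q = (q : ℂ) • x.coeff q := rfl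

theorem euler_mul {R : Type*} [CommRing R] [Algebra ℂ R] (x y : HahnSeries ℚ R) :
    euler R (x * y) = x * euler R y + y * euler R x := by
  ext q
  have h1 : ∀ z : HahnSeries ℚ R, (euler R z).support ⊆ z.support :=
    fun z q hq h => hq (by simp [h])
  simp only [coeff_euler, coeff_add]
  rw [mul_comm y, coeff_mul, coeff_mul_right' y.isPWO_support (h1 y),
    coeff_mul_left' x.isPWO_support (h1 x), Finset.smul_sum, ← Finset.sum_add_distrib]
  refine Finset.sum_congr rfl fun ij hij => ?_
  have : ij.1 + ij.2 = q := (Finset.mem_antidiagonal.1 hij).2.2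
  rw [← this]
  simp only [Rat.cast_add, add_smul, smul_mul_assoc, mul_smul_comm, coeff_euler]
  rw [add_comm]

@[simp]
theorem euler_single {R : Type*} [CommRing R] [Algebra ℂ R] (a : ℚ) (r : R) :
    euler R (single a r) = single a ((a : ℂ) • r) := by
  ext q
  rw [coeff_euler, coeff_single, coeff_single]
  split_ifs with h
  · rw [h]
  · simp

/-- A derivation of the coefficient ring acts on Hahn series. -/
noncomputable def coeffDerivation {R : Type*} [CommRing R] [Algebra ℂ R]
    (D : Derivation ℂ R R) : HahnSeries ℚ R →+ HahnSeries ℚ R where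
  toFun x :=
    { coeff := fun q => D (x.coeff q)
      isPWO_support' := x.isPWO_support.mono fun q hq h => hq (by simp [h]) }
  map_zero' := by ext q; simp
  map_add' x y := by ext q; simp

@[simp]
theorem coeff_coeffDerivation {R : Type*} [CommRing R] [Algebra ℂ R] (D : Derivation ℂ R R)
    (x : HahnSeries ℚ R) (q : ℚ) : (coeffDerivation D x).coeff q = D (x.coeff q) := rfl

theorem coeffDerivation_mul {R : Type*} [CommRing R] [Algebra ℂ R] (D : Derivation ℂ R R)
    (x y : HahnSeries ℚ R) :
    coeffDerivation D (x * y) = x * coeffDerivation D y + y * coeffDerivation D x := by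
  ext q
  have h1 : ∀ z : HahnSeries ℚ R, (coeffDerivation D z).support ⊆ z.support :=
    fun z q hq h => hq (by simp [h])
  simp only [coeff_coeffDerivation, coeff_add]
  rw [mul_comm y, coeff_mul, coeff_mul_right' y.isPWO_support (h1 y),
    coeff_mul_left' x.isPWO_support (h1 x), map_sum, ← Finset.sum_add_distrib]
  refine Finset.sum_congr rfl fun ij hij => ?_
  simp only [Derivation.leibniz, smul_eq_mul, coeff_coeffDerivation]
  ring

@[simp]
theorem coeffDerivation_single {R : Type*} [CommRing R] [Algebra ℂ R] (D : Derivation ℂ R R)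
    (a : ℚ) (r : R) : coeffDerivation D (single a r) = single a (D r) := by
  ext q
  rw [coeff_coeffDerivation, coeff_single, coeff_single]
  split_ifs with h
  · rfl
  · simp

theorem coeff_mul_of_le_orderTop {R : Type*} [CommRing R] {x y : HahnSeries ℚ R} {a b : ℚ}
    (hx : a ≤ x.orderTop) (hy : b ≤ y.orderTop) :
    (x * y).coeff (a + b) = x.coeff a * y.coeff b := by
  rw [coeff_mul]
  rw [le_orderTop_iff_forall] at hx hy
  rw [Finset.sum_eq_single (a, b)]
  · rintro ⟨i, j⟩ hij hne
    obtain ⟨-, -, h⟩ := Finset.mem_antidiagonal.1 hij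
    simp only at h
    rcases lt_trichotomy i a with hi | hi | hi
    · simp [hx i (by exact_mod_cast hi)]
    · subst hi
      exact absurd (by simpa using h) (fun h' => hne (by rw [h']))
    · simp [hy j (by exact_mod_cast (by linarith : j < b))]
  · intro h
    by_contra hne
    exact h (Finset.mem_antidiagonal.2
      ⟨fun h0 => hne (by simp [h0]), fun h0 => hne (by simp [h0]), rfl⟩)

theorem le_orderTop_mul {R : Type*} [CommRing R] {x y : HahnSeries ℚ R} {a b : ℚ}
    (hx : a ≤ x.orderTop) (hy : b ≤ y.orderTop) : ((a + b : ℚ) : WithTop ℚ) ≤ (x * y).orderTop := by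
  refine le_trans ?_ orderTop_add_le_mul
  push_cast
  exact add_le_add hx hy

theorem le_orderTop_pow {R : Type*} [CommRing R] {x : HahnSeries ℚ R} {a : ℚ}
    (hx : a ≤ x.orderTop) (n : ℕ) : ((n * a : ℚ) : WithTop ℚ) ≤ (x ^ n).orderTop := by
  induction n with
  | zero => 
    rw [le_orderTop_iff_forall]
    intro q hq
    rw [pow_zero, coeff_one, if_neg]
    rintro rfl
    simp at hq
  | succ n ih =>
    rw [pow_succ]
    have := le_orderTop_mul ih hx
    convert this using 2
    push_cast; ring

theorem le_orderTop_add {R : Type*} [CommRing R] {x y : HahnSeries ℚ R} {a : WithTop ℚ}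
    (hx : a ≤ x.orderTop) (hy : a ≤ y.orderTop) : a ≤ (x + y).orderTop :=
  (le_min hx hy).trans min_orderTop_le_orderTop_add

theorem le_orderTop_sum {R ι : Type*} [CommRing R] (s : Finset ι) {x : ι → HahnSeries ℚ R}
    {a : WithTop ℚ} (hx : ∀ i ∈ s, a ≤ (x i).orderTop) : a ≤ (∑ i ∈ s, x i).orderTop := by
  rw [le_orderTop_iff_forall]
  intro q hq
  rw [coeff_sum]
  exact Finset.sum_eq_zero fun i hi => le_orderTop_iff_forall.1 (hx i hi) q hq

end HahnSeries

/-! ### Newton polygons over Hahn series -/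

namespace HahnSeries

variable {k : Type*} [Field k]

/-- The substitution `Y = ξ t ^ s`, which turns a polynomial in `Y` over the Hahn series in `t`
into a Hahn series in `t` with coefficients polynomial in `ξ`. -/
noncomputable def rescale (s : ℚ) : (HahnSeries ℚ k)[X] →+* HahnSeries ℚ k[X] :=
  eval₂RingHom (coeffRingHom Polynomial.C) (single s X)

theorem coeff_coeff_rescale (F : (HahnSeries ℚ k)[X]) (s q : ℚ) (n : ℕ) :
    ((rescale s F).coeff q).coeff n = (F.coeff n).coeff (q - n * s) := by
  induction F using Polynomial.induction_on' with
  | add F G hF hG => simp [hF, hG]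
  | monomial m a =>
    rw [rescale, coe_eval₂RingHom, eval₂_monomial, single_pow, coeff_mul_single,
      coeff_coeffRingHom, Polynomial.coeff_C_mul, coeff_X_pow, coeff_monomial]
    by_cases h : n = m
    · subst h; simp
    · simp [h, Ne.symm h]

/-- All terms of `F(ξ t ^ s)` have exponent at least `w`. -/
def HasWeight (F : (HahnSeries ℚ k)[X]) (s w : ℚ) : Prop :=
  ∀ n : ℕ, ((w - n * s : ℚ) : WithTop ℚ) ≤ (F.coeff n).orderTop

theorem hasWeight_iff {F : (HahnSeries ℚ k)[X]} {s w : ℚ} :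
    HasWeight F s w ↔ ∀ (n : ℕ) (q : ℚ), q < w - n * s → (F.coeff n).coeff q = 0 := by
  simp only [HasWeight, le_orderTop_iff_forall, WithTop.coe_lt_coe]

theorem HasWeight.le_orderTop_rescale {F : (HahnSeries ℚ k)[X]} {s w : ℚ}
    (h : HasWeight F s w) : w ≤ (rescale s F).orderTop := by
  rw [le_orderTop_iff_forall]
  intro q hq
  ext n
  rw [coeff_coeff_rescale]
  exact hasWeight_iff.1 h n _ (by have := WithTop.coe_lt_coe.1 hq; linarith)

theorem coeffRingHom_eval_rescale (F : (HahnSeries ℚ k)[X]) (s : ℚ) (c : k) :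
    coeffRingHom (evalRingHom c) (rescale s F) = F.eval (single s c) := by
  induction F using Polynomial.induction_on' with
  | add F G hF hG => simp only [map_add, eval_add, hF, hG]
  | monomial m a =>
    rw [rescale, coe_eval₂RingHom, eval₂_monomial, eval_monomial, map_mul, map_pow,
      coeffRingHom_single]
    congr 1
    · ext q; simp
    · simp

/-- Replacing a factor `Y` by `δ` loses nothing, since `δ` has order at least `s`, the exponent
assigned to `Y`. -/
theorem HasWeight.taylor {F : (HahnSeries ℚ k)[X]} {s w : ℚ} (h : HasWeight F s w)
    {δ : HahnSeries ℚ k} (hδ : s ≤ δ.orderTop) : HasWeight (F.taylor δ) s w := by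
  intro n
  rw [taylor_coeff, eval_eq_sum_range]
  refine le_orderTop_sum _ fun i _ => ?_
  rw [hasseDeriv_coeff, mul_assoc, ← nsmul_eq_mul ((i + n).choose n)]
  have h1 := le_orderTop_mul (h (i + n)) (le_orderTop_pow hδ i)
  have h2 : w - ((i + n : ℕ) : ℚ) * s + i * s = w - n * s := by push_cast; ring
  rw [h2] at h1
  rw [le_orderTop_iff_forall] at h1 ⊢
  intro q hq
  rw [coeff_nsmul, Pi.smul_apply, h1 q hq, smul_zero]

theorem HasWeight.le_orderTop_eval {F : (HahnSeries ℚ k)[X]} {s w : ℚ} (h : HasWeight F s w)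
    {δ : HahnSeries ℚ k} (hδ : s ≤ δ.orderTop) : w ≤ (F.eval δ).orderTop := by
  have := h.taylor hδ 0
  simpa [taylor_coeff_zero] using this

theorem HasWeight.mono {F : (HahnSeries ℚ k)[X]} {s s' w w' : ℚ} (h : HasWeight F s w)
    (hs : s ≤ s') (hw : w' ≤ w) : HasWeight F s' w' := by
  intro n
  refine le_trans (WithTop.coe_le_coe.2 ?_) (h n)
  have : (n : ℚ) * s ≤ n * s' := mul_le_mul_of_nonneg_left hs n.cast_nonneg
  linarith

/-- The first slope of the Newton polygon of a polynomial with nonzero constant term. -/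
theorem exists_slope {F : (HahnSeries ℚ k)[X]} (h : ∃ n ≠ 0, F.coeff n ≠ 0) (w : ℚ)
    (hw : w ≤ (F.coeff 0).orderTop) :
    ∃ s, HasWeight F s w ∧ ∃ n ≠ 0, (F.coeff n).coeff (w - n * s) ≠ 0 := by
  obtain ⟨n₀, hn₀, h0⟩ := h
  -- Among the lines from `(0, w)` to the points `(n, order)`, the lowest one has all other points
  -- on or above it; `s` is minus its slope.
  obtain ⟨n, hn, hmax⟩ := (F.support.erase 0).exists_max_image
    (fun n => (w - (F.coeff n).order) / n) ⟨n₀, by simp [hn₀, h0]⟩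
  simp only [Finset.mem_erase, mem_support_iff] at hn hmax
  refine ⟨(w - (F.coeff n).order) / n, fun m => ?_, n, hn.1, ?_⟩
  · rcases eq_or_ne m 0 with rfl | hm
    · simpa using hw
    · rcases eq_or_ne (F.coeff m) 0 with h | h
      · simp [h]
      rw [← order_eq_orderTop_of_ne_zero h]
      have h1 := hmax m ⟨hm, h⟩
      have hm' : (0 : ℚ) < m := by exact_mod_cast Nat.pos_of_ne_zero hm
      rw [div_le_iff₀ hm'] at h1
      exact WithTop.coe_le_coe.2 (by linarith)
  · have hn' : (n : ℚ) ≠ 0 := by exact_mod_cast hn.1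
    rw [mul_div_cancel₀ _ hn', sub_sub_cancel]
    exact fun h => hn.2 (coeff_order_eq_zero.1 h)

/-- Spherical completeness, which bounds chains in Zorn's lemma: each member prescribes the
coefficients below its own radius, and these prescriptions glue. -/
theorem exists_pseudoLimit {c : Set (HahnSeries ℚ k)} {s : HahnSeries ℚ k → ℚ}
    (hc : ∀ φ ∈ c, ∀ ψ ∈ c, ∀ q, q < s φ → q < s ψ → φ.coeff q = ψ.coeff q) :
    ∃ L : HahnSeries ℚ k, ∀ φ ∈ c, s φ ≤ (L - φ).orderTop := by
  classical
  let g : ℚ → k := fun q => if h : ∃ φ ∈ c, q < s φ then h.choose.coeff q else 0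
  have hg : ∀ φ ∈ c, ∀ q, q < s φ → g q = φ.coeff q := by
    intro φ hφ q hq
    have h : ∃ φ ∈ c, q < s φ := ⟨φ, hφ, hq⟩
    simp only [g, dif_pos h]
    exact hc _ h.choose_spec.1 _ hφ _ h.choose_spec.2 hq
  have hex : ∀ q, g q ≠ 0 → ∃ φ ∈ c, q < s φ := by
    intro q hq
    by_contra h
    exact hq (by simp only [g, dif_neg h])
  -- A descending sequence stays below the radius of one member, hence inside the well-ordered
  -- support of that member.
  have hwf : (Function.support g).IsWF := by
    rw [Set.isWF_iff_no_descending_seq]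
    intro a ha hmem
    obtain ⟨φ, hφ, hlt⟩ := hex _ (hmem 0)
    refine (Set.isWF_iff_no_descending_seq.1 φ.isWF_support) a ha ?_
    intro n
    have hn : a n < s φ := lt_of_le_of_lt (ha.antitone (Nat.zero_le n)) hlt
    have := hmem n
    rw [Function.mem_support, hg φ hφ _ hn] at this
    exact this
  refine ⟨⟨g, hwf.isPWO⟩, fun φ hφ => ?_⟩
  rw [le_orderTop_iff_forall]
  intro q hq
  rw [coeff_sub, sub_eq_zero]
  exact hg φ hφ q (WithTop.coe_lt_coe.1 hq)

/-- Newton's method, continued transfinitely. If `φ` is not a root, adding `c t ^ s` with `s` the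
first slope at `φ` and `c` a root of the initial form raises the order of `f`. Zorn's lemma yields a
centre that cannot be improved, a contradiction. -/
theorem exists_eval_eq_zero [IsAlgClosed k] (f : (HahnSeries ℚ k)[X]) (hf : f.natDegree ≠ 0) :
    ∃ φ, f.eval φ = 0 := by
  by_contra! hno
  have hslope : ∀ φ, ∃ s, HasWeight (f.taylor φ) s (f.eval φ).order ∧
      ∃ n ≠ 0, ((f.taylor φ).coeff n).coeff ((f.eval φ).order - n * s) ≠ 0 := by
    intro φ
    refine exists_slope ⟨f.natDegree, hf, ?_⟩ _ ?_
    · have h := natDegree_taylor f φ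
      rw [← h, coeff_natDegree, Polynomial.leadingCoeff_ne_zero]
      rintro h0
      rw [h0] at h
      exact hf (by simpa using h.symm)
    · rw [taylor_coeff_zero, order_eq_orderTop_of_ne_zero (hno φ)]
  choose s hs hs' using hslope
  let r : HahnSeries ℚ k → HahnSeries ℚ k → Prop := fun φ ψ =>
    s φ ≤ (ψ - φ).orderTop ∧ (f.eval φ).order < (f.eval ψ).order
  have hshift : ∀ φ ψ, (f.taylor ψ).taylor (φ - ψ) = f.taylor φ := by
    intro φ ψ
    rw [taylor_taylor, sub_add_cancel]
  -- Otherwise the weight bound at `ψ` would hold on the ball of radius `s φ` about `ψ`, which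
  -- contains `φ`, and `f` would have at least as large an order at `φ` as at `ψ`.
  have hmono : ∀ φ ψ, r φ ψ → s φ ≤ s ψ := by
    rintro φ ψ ⟨h1, h2⟩
    by_contra! hlt
    have h3 : HasWeight (f.taylor ψ) (s φ) (f.eval ψ).order := (hs ψ).mono hlt.le le_rfl
    have h4 := h3.taylor (δ := φ - ψ) (by rwa [← neg_sub, orderTop_neg])
    rw [hshift] at h4
    have h5 := h4 0
    rw [taylor_coeff_zero, ← order_eq_orderTop_of_ne_zero (hno φ)] at h5
    have := WithTop.coe_le_coe.1 h5
    simp only [Nat.cast_zero, zero_mul, sub_zero] at this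
    linarith
  have htrans : ∀ {a b c}, r a b → r b c → r a c := by
    intro a b c hab hbc
    refine ⟨?_, hab.2.trans hbc.2⟩
    have := le_orderTop_add hab.1
      (le_trans (WithTop.coe_le_coe.2 (hmono a b hab)) hbc.1)
    simpa using this
  have himp : ∀ φ, ∃ ψ, r φ ψ := by
    intro φ
    set w := (f.eval φ).order with hw
    set p := (rescale (s φ) (f.taylor φ)).coeff w with hp
    obtain ⟨n, hn, hpn⟩ := hs' φ
    have hdeg : p.degree ≠ 0 := by
      intro h
      rw [eq_C_of_degree_eq_zero h] at hp
      apply hpn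
      rw [← coeff_coeff_rescale, ← hw, ← hp, coeff_C, if_neg hn]
    obtain ⟨c, hc⟩ := IsAlgClosed.exists_root p hdeg
    refine ⟨φ + single (s φ) c, by simpa using orderTop_single_le, ?_⟩
    have h0 := hno (φ + single (s φ) c)
    have h1 : ∀ q, (f.eval (φ + single (s φ) c)).coeff q =
        ((rescale (s φ) (f.taylor φ)).coeff q).eval c := by
      intro q
      rw [← coe_evalRingHom c, ← coeff_coeffRingHom, coeffRingHom_eval_rescale, taylor_eval,
        add_comm]
    have h2 := le_orderTop_iff_forall.1 (hs φ).le_orderTop_rescale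
    by_contra! hle
    have h3 : (f.eval (φ + single (s φ) c)).coeff (f.eval (φ + single (s φ) c)).order ≠ 0 :=
      fun h => h0 (coeff_order_eq_zero.1 h)
    rcases hle.lt_or_eq with hlt | heq
    · exact h3 (by rw [h1, h2 _ (WithTop.coe_lt_coe.2 hlt), eval_zero])
    · exact h3 (by rw [heq, h1]; exact hc)
  obtain ⟨m, hm⟩ := exists_maximal_of_chains_bounded (r := r) (fun c hc => by
    -- A chain with a greatest element is bounded by one Newton step beyond it, any other chain by a
    -- pseudo-limit.
    by_cases hmax : ∃ m ∈ c, ∀ a ∈ c, a = m ∨ r a m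
    · obtain ⟨m, hm, hm'⟩ := hmax
      obtain ⟨ψ, hψ⟩ := himp m
      refine ⟨ψ, fun a ha => ?_⟩
      rcases hm' a ha with rfl | h
      · exact hψ
      · exact htrans h hψ
    · push Not at hmax
      have hnext : ∀ m ∈ c, ∃ a ∈ c, r m a := by
        intro m hm
        obtain ⟨a, ha, hne, hr⟩ := hmax m hm
        exact ⟨a, ha, (hc hm ha hne.symm).resolve_right hr⟩
      obtain ⟨L, hL⟩ := exists_pseudoLimit (c := c) (s := s) (by
        have key : ∀ φ ψ, r φ ψ → ∀ q, q < s φ → φ.coeff q = ψ.coeff q := by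
          intro φ ψ h q hq
          have := le_orderTop_iff_forall.1 h.1 q (WithTop.coe_lt_coe.2 hq)
          rw [coeff_sub, sub_eq_zero] at this
          exact this.symm
        intro φ hφ ψ hψ q h1 h2
        by_cases hne : φ = ψ
        · rw [hne]
        · rcases hc hφ hψ hne with h | h
          · exact key _ _ h _ h1
          · exact (key _ _ h _ h2).symm)
      refine ⟨L, fun a ha => ⟨hL a ha, ?_⟩⟩
      obtain ⟨b, hb, hab⟩ := hnext a ha
      refine hab.2.trans_le ?_
      have h1 := (hs b).le_orderTop_eval (hL b hb)
      rw [taylor_eval, sub_add_cancel, ← order_eq_orderTop_of_ne_zero (hno L)] at h1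
      exact WithTop.coe_le_coe.1 h1) htrans
  obtain ⟨ψ, hψ⟩ := himp m
  exact lt_asymm hψ.2 (hm ψ hψ).2

instance instIsAlgClosed [IsAlgClosed k] : IsAlgClosed (HahnSeries ℚ k) :=
  IsAlgClosed.of_exists_root _ fun p _ hirr =>
    exists_eval_eq_zero p hirr.natDegree_pos.ne'

end HahnSeries

/-! ### Newton polygons of pairs with constant Wronskian -/

namespace Polynomial

theorem natDegree_eq_of_derivative_mul_eq {h g : ℂ[X]} (hh : h ≠ 0) (hg : g ≠ 0)
    (H : derivative h * g = h * derivative g) : h.natDegree = g.natDegree := by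
  by_cases h0 : h.natDegree = 0
  · rw [eq_C_of_natDegree_eq_zero h0, derivative_C, zero_mul, eq_comm, mul_eq_zero,
      ← eq_C_of_natDegree_eq_zero h0] at H
    rw [h0, derivative_eq_zero.1 (H.resolve_left hh)]
  by_cases g0 : g.natDegree = 0
  · rw [eq_C_of_natDegree_eq_zero g0, derivative_C, mul_zero, mul_eq_zero,
      ← eq_C_of_natDegree_eq_zero g0] at H
    exact absurd (derivative_eq_zero.1 (H.resolve_right hg)) h0
  have := congrArg leadingCoeff H
  simp only [leadingCoeff_mul, leadingCoeff_derivative] at this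
  have hlh := leadingCoeff_ne_zero.2 hh
  have hlg := leadingCoeff_ne_zero.2 hg
  have h2 : (h.natDegree : ℂ) = g.natDegree := by
    apply mul_left_cancel₀ (mul_ne_zero hlh hlg)
    linear_combination this
  exact_mod_cast h2

/-- Otherwise `f - g` solves the same linear equation in smaller degree, whereas every nonzero
solution has the degree of `g`. -/
theorem eq_of_derivative_mul_eq {f g : ℂ[X]} (hf : f ≠ 0) (hg : g ≠ 0)
    (H : derivative f * g = f * derivative g) (hl : f.leadingCoeff = g.leadingCoeff) : f = g := by
  have hn := natDegree_eq_of_derivative_mul_eq hf hg H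
  have hd : f.degree = g.degree := by rw [degree_eq_natDegree hf, degree_eq_natDegree hg, hn]
  by_contra hne
  have hlt := degree_sub_lt_left hd hf hl
  have h0 : f - g ≠ 0 := sub_ne_zero.2 hne
  have := natDegree_eq_of_derivative_mul_eq h0 hg (by rw [derivative_sub]; linear_combination H)
  rw [degree_eq_natDegree h0, degree_eq_natDegree hf, this, hn] at hlt
  exact lt_irrefl _ hlt

/-- Both sides have the same logarithmic derivative, as `e p' / p = d q' / q`, and the same leading
coefficient. -/
theorem pow_mul_eq_of_derivative {p q : ℂ[X]} {d e : ℕ} {A B : ℂ} (hp : p ≠ 0) (hq : q ≠ 0)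
    (hA : A ≠ 0) (hB : B ≠ 0)
    (H : C (d : ℂ) * (p * derivative q) = C (e : ℂ) * (derivative p * q))
    (hl : p.leadingCoeff ^ e * B ^ d = A ^ e * q.leadingCoeff ^ d) :
    p ^ e * C (B ^ d) = C (A ^ e) * q ^ d := by
  have hpow : ∀ (n : ℕ) (f : ℂ[X]), f * derivative (f ^ n) = C (n : ℂ) * (derivative f * f ^ n) := by
    rintro (_ | n) f
    · simp
    · rw [derivative_pow_succ, pow_succ f n]
      push_cast
      ring
  refine eq_of_derivative_mul_eq
    (mul_ne_zero (pow_ne_zero _ hp) (C_ne_zero.2 (pow_ne_zero _ hB)))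
    (mul_ne_zero (C_ne_zero.2 (pow_ne_zero _ hA)) (pow_ne_zero _ hq)) ?_ (by simpa using hl)
  apply mul_left_cancel₀ (mul_ne_zero hp hq)
  rw [derivative_mul, derivative_mul, derivative_C, derivative_C]
  linear_combination (C (A ^ e) * C (B ^ d)) * (q * q ^ d * hpow e p - p * p ^ e * hpow d q
    - p ^ e * q ^ d * H)

theorem natTrailingDegree_pow_eq {p : ℂ[X]} (hp : p ≠ 0) (n : ℕ) :
    (p ^ n).natTrailingDegree = n * p.natTrailingDegree := by
  induction n with
  | zero => simp
  | succ n ih => rw [pow_succ, natTrailingDegree_mul (pow_ne_zero _ hp) hp, ih]; ring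

theorem trailingCoeff_pow_eq (p : ℂ[X]) (n : ℕ) :
    (p ^ n).trailingCoeff = p.trailingCoeff ^ n := by
  induction n with
  | zero => simp [trailingCoeff]
  | succ n ih => rw [pow_succ, trailingCoeff_mul, ih, pow_succ]

theorem trailing_of_pow_mul_eq {p q : ℂ[X]} {d e : ℕ} {A B : ℂ} (hp : p ≠ 0) (hq : q ≠ 0)
    (hA : A ≠ 0) (hB : B ≠ 0)
    (h : p ^ e * C (B ^ d) = C (A ^ e) * q ^ d) :
    e * p.natTrailingDegree = d * q.natTrailingDegree ∧
      p.trailingCoeff ^ e * B ^ d = A ^ e * q.trailingCoeff ^ d := by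
  have hC : ∀ c : ℂ, (C c).trailingCoeff = c := by
    intro c
    rw [trailingCoeff, natTrailingDegree_C, coeff_C_zero]
  constructor
  · have := congrArg natTrailingDegree h
    rwa [natTrailingDegree_mul (pow_ne_zero _ hp) (by simpa using fun h => absurd h hB),
      natTrailingDegree_mul (by simpa using fun h => absurd h hA) (pow_ne_zero _ hq),
      natTrailingDegree_pow_eq hp, natTrailingDegree_pow_eq hq, natTrailingDegree_C,
      natTrailingDegree_C, add_zero, zero_add] at this
  · have := congrArg trailingCoeff h
    rwa [trailingCoeff_mul, trailingCoeff_mul, trailingCoeff_pow_eq, trailingCoeff_pow_eq, hC,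
      hC] at this

end Polynomial

/-! ### Initial forms and the descent along the two Newton polygons -/

namespace HahnSeries

/-- The initial form of `F(ξ t ^ s)` with respect to the exponent `w`. -/
noncomputable def initialForm {k : Type*} [Field k] (F : (HahnSeries ℚ k)[X]) (s w : ℚ) : k[X] :=
  (rescale s F).coeff w

theorem coeff_initialForm {k : Type*} [Field k] (F : (HahnSeries ℚ k)[X]) (s w : ℚ) (n : ℕ) :
    (initialForm F s w).coeff n = (F.coeff n).coeff (w - n * s) :=
  coeff_coeff_rescale F s w n

section Slopes

variable {k : Type*} [Field k] {F : (HahnSeries ℚ k)[X]} {s w : ℚ}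

theorem coeff_initialForm_add (n : ℕ) (ρ : ℚ) :
    (initialForm F (s + ρ) (w + n * ρ)).coeff n = (initialForm F s w).coeff n := by
  rw [coeff_initialForm, coeff_initialForm]
  congr 1
  ring

theorem HasWeight.natDegree_initialForm_add (h : HasWeight F s w) {n : ℕ}
    (hn : (initialForm F s w).coeff n ≠ 0) {ρ : ℚ} (hρ : 0 < ρ) :
    (initialForm F (s + ρ) (w + n * ρ)).natDegree = n := by
  refine natDegree_eq_of_le_of_coeff_ne_zero ?_ (by rwa [coeff_initialForm_add])
  rw [natDegree_le_iff_coeff_eq_zero]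
  intro m hm
  rw [coeff_initialForm]
  apply hasWeight_iff.1 h
  have : (n : ℚ) < m := by exact_mod_cast hm
  nlinarith

/-- Changing `(s, w)` to `(s + ρ, w + n ρ)` turns the supporting line about the vertex of degree
`n`, away from the terms of higher degree. Only a term of degree `m < n` can stop it, at `ρ = (order
+ m s - w) / (n - m)`; the smallest such value is the next break. -/
theorem HasWeight.exists_break (h : HasWeight F s w) {n : ℕ}
    (hn : ∀ m < n, (initialForm F s w).coeff m = 0) :
    (∀ ρ, 0 ≤ ρ → HasWeight F (s + ρ) (w + n * ρ)) ∨
    ∃ ρ > 0, (∀ ρ', 0 ≤ ρ' → ρ' ≤ ρ → HasWeight F (s + ρ') (w + n * ρ')) ∧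
      ∃ m < n, (initialForm F (s + ρ) (w + n * ρ)).coeff m ≠ 0 := by
  have hgt : ∀ ρ m, 0 ≤ ρ → n ≤ m →
      ((w + n * ρ - m * (s + ρ) : ℚ) : WithTop ℚ) ≤ (F.coeff m).orderTop := by
    intro ρ m hρ hm
    refine le_trans (WithTop.coe_le_coe.2 ?_) (h m)
    have : (n : ℚ) ≤ m := by exact_mod_cast hm
    nlinarith
  have hlt : ∀ ρ m, m < n → F.coeff m ≠ 0 →
      ρ ≤ ((F.coeff m).order + m * s - w) / (n - m) →
      ((w + n * ρ - m * (s + ρ) : ℚ) : WithTop ℚ) ≤ (F.coeff m).orderTop := by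
    intro ρ m hm h0 hρ
    have : (0 : ℚ) < n - m := by
      have : (m : ℚ) < n := by exact_mod_cast hm
      linarith
    rw [le_div_iff₀ this] at hρ
    rw [← order_eq_orderTop_of_ne_zero h0]
    exact WithTop.coe_le_coe.2 (by linarith)
  by_cases hS : ((Finset.range n).filter fun m => F.coeff m ≠ 0).Nonempty
  · right
    obtain ⟨m, hm, hmin⟩ := Finset.exists_min_image _
      (fun m : ℕ => ((F.coeff m).order + m * s - w) / ((n : ℚ) - m)) hS
    simp only [Finset.mem_filter, Finset.mem_range] at hm hmin
    have hmn : (0 : ℚ) < n - m := by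
      have : (m : ℚ) < n := by exact_mod_cast hm.1
      linarith
    refine ⟨((F.coeff m).order + m * s - w) / (n - m), ?_, fun ρ' h1 h2 j => ?_, m, hm.1, ?_⟩
    · apply div_pos _ hmn
      have h1 := h m
      rw [← order_eq_orderTop_of_ne_zero hm.2] at h1
      have h2 := WithTop.coe_le_coe.1 h1
      have h3 : w - m * s ≠ (F.coeff m).order := by
        intro h4
        have h5 := hn m hm.1
        rw [coeff_initialForm, h4] at h5
        exact hm.2 (coeff_order_eq_zero.1 h5)
      have := lt_of_le_of_ne h2 h3
      linarith
    · rcases lt_or_ge j n with hj | hj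
      · by_cases h0 : F.coeff j = 0
        · simp [h0]
        · exact hlt _ _ hj h0 (h2.trans (hmin j ⟨hj, h0⟩))
      · exact hgt _ _ h1 hj
    · rw [coeff_initialForm]
      have h1 : w + n * (((F.coeff m).order + m * s - w) / (n - m)) -
          m * (s + ((F.coeff m).order + m * s - w) / (n - m)) = (F.coeff m).order := by
        field_simp
        ring
      rw [h1]
      exact fun h => hm.2 (coeff_order_eq_zero.1 h)
  · left
    intro ρ hρ m
    rcases lt_or_ge m n with hm | hm
    · have h0 : F.coeff m = 0 := by
        by_contra h0
        exact hS ⟨m, by simp [hm, h0]⟩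
      simp [h0]
    · exact hgt _ _ hρ hm

/-- For very negative `s` the initial form is the leading term. -/
theorem eventually_atBot_hasWeight {N : ℕ} {a : k} (hN : F.natDegree ≤ N)
    (ha : F.coeff N = C a) :
    ∀ᶠ s in atBot, HasWeight F s (N * s) ∧ initialForm F s (N * s) = Polynomial.monomial N a := by
  have h1 : ∀ᶠ s : ℚ in atBot, ∀ n ∈ Finset.range N, N * s - n * s < (F.coeff n).order := by
    rw [Finset.eventually_all]
    intro n hn
    have hn : (0 : ℚ) < N - n := by
      have : (n : ℚ) < N := by exact_mod_cast Finset.mem_range.1 hn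
      linarith
    filter_upwards [eventually_lt_atBot ((F.coeff n).order / ((N : ℚ) - n))] with s hs
    rw [lt_div_iff₀ hn] at hs
    linarith
  filter_upwards [h1] with s hs
  have h2 : ∀ (n : ℕ) (q : ℚ), q ≤ N * s - n * s → n ≠ N → (F.coeff n).coeff q = 0 := by
    intro n q hq hne
    rcases lt_or_gt_of_ne hne with h | h
    · exact coeff_eq_zero_of_lt_order (hq.trans_lt (hs n (Finset.mem_range.2 h)))
    · rw [coeff_eq_zero_of_natDegree_lt (hN.trans_lt h), coeff_zero]
  refine ⟨hasWeight_iff.2 fun n q hq => ?_, ?_⟩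
  · rcases eq_or_ne n N with rfl | h
    · rw [ha, C_apply, coeff_single_of_ne (by linarith [hq])]
    · exact h2 n q hq.le h
  · ext n
    rw [coeff_initialForm, coeff_monomial]
    split_ifs with h
    · subst h
      rw [ha, sub_self, C_apply, coeff_single_same]
    · exact h2 n _ le_rfl (Ne.symm h)

end Slopes

/-- The polynomial parametrization `ξ ↦ (p(ξ), q(ξ))` goes to infinity along
`(u / A) ^ e = (v / B) ^ d`. -/
structure SimilarAtInfinity (d e : ℕ) (A B : ℂ) (p q : ℂ[X]) : Prop where
  natDegree_ne_zero : p.natDegree ≠ 0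
  natDegree_mul : e * p.natDegree = d * q.natDegree
  leadingCoeff_pow : p.leadingCoeff ^ e * B ^ d = A ^ e * q.leadingCoeff ^ d

section Descent

variable {F G : (HahnSeries ℚ ℂ)[X]} {d e : ℕ} {A B : ℂ}

theorem exists_common_break {s w w' : ℚ} (hF : HasWeight F s w) (hG : HasWeight G s w') {m n : ℕ}
    (hm : ∀ i < m, (initialForm F s w).coeff i = 0) (hn : ∀ i < n, (initialForm G s w').coeff i = 0)
    {ρ₀ : ℚ} (hρ₀ : 0 < ρ₀) :
    ∃ ρ, 0 < ρ ∧ ρ ≤ ρ₀ ∧ HasWeight F (s + ρ) (w + m * ρ) ∧ HasWeight G (s + ρ) (w' + n * ρ) ∧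
      (ρ < ρ₀ → (∃ i < m, (initialForm F (s + ρ) (w + m * ρ)).coeff i ≠ 0) ∨
        ∃ i < n, (initialForm G (s + ρ) (w' + n * ρ)).coeff i ≠ 0) := by
  have h1 : ∃ ρ, 0 < ρ ∧ ρ ≤ ρ₀ ∧
      (∀ ρ', 0 ≤ ρ' → ρ' ≤ ρ → HasWeight F (s + ρ') (w + m * ρ')) ∧
      (ρ < ρ₀ → ∃ i < m, (initialForm F (s + ρ) (w + m * ρ)).coeff i ≠ 0) := by
    rcases hF.exists_break hm with h | ⟨ρ, hρ, h, h'⟩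
    · exact ⟨ρ₀, hρ₀, le_rfl, fun ρ' h1 _ => h ρ' h1, fun h => absurd h (lt_irrefl _)⟩
    · rcases le_or_gt ρ ρ₀ with hle | hlt
      · exact ⟨ρ, hρ, hle, h, fun _ => h'⟩
      · exact ⟨ρ₀, hρ₀, le_rfl, fun ρ' h1 h2 => h ρ' h1 (h2.trans hlt.le),
          fun h => absurd h (lt_irrefl _)⟩
  obtain ⟨ρ₁, hρ₁, hle₁, hF₁, hi₁⟩ := h1
  rcases hG.exists_break hn with h | ⟨ρ, hρ, h, h'⟩
  · exact ⟨ρ₁, hρ₁, hle₁, hF₁ _ hρ₁.le le_rfl, h _ hρ₁.le, fun h => Or.inl (hi₁ h)⟩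
  · rcases le_or_gt ρ ρ₁ with hle | hlt
    · exact ⟨ρ, hρ, hle.trans hle₁, hF₁ _ hρ.le hle, h _ hρ.le le_rfl, fun _ => Or.inr h'⟩
    · exact ⟨ρ₁, hρ₁, hle₁, hF₁ _ hρ₁.le le_rfl, h _ hρ₁.le hlt.le, fun h => Or.inl (hi₁ h)⟩

/-- If the Wronskians of the initial forms of `F` and `G` are constant, then the Newton polygons
of `F` and `G` are similar above the level where both have weight zero. -/
theorem exists_similarAtInfinity_of_pow_mul_eq (hd : d ≠ 0) (he : e ≠ 0) (hA : A ≠ 0) (hB : B ≠ 0)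
    (hF0 : 0 ≤ (F.coeff 0).orderTop) (hG0 : 0 ≤ (G.coeff 0).orderTop)
    (hW : ∀ s w w', HasWeight F s w → HasWeight G s w' → ∃ c : ℂ,
      Polynomial.C (w : ℂ) * (initialForm F s w * derivative (initialForm G s w')) -
        Polynomial.C (w' : ℂ) * (derivative (initialForm F s w) * initialForm G s w') =
          Polynomial.C c)
    {s w w' : ℚ} (hF : HasWeight F s w) (hG : HasWeight G s w') (hw : w < 0)
    (hww : e * w = d * w')
    (hp : initialForm F s w ≠ 0) (hq : initialForm G s w' ≠ 0)
    (hpq : initialForm F s w ^ e * Polynomial.C (B ^ d) =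
      Polynomial.C (A ^ e) * initialForm G s w' ^ d) :
    ∃ r, HasWeight F r 0 ∧ HasWeight G r 0 ∧
      SimilarAtInfinity d e A B (initialForm F r 0) (initialForm G r 0) := by
  have hd' : (0 : ℚ) < d := by exact_mod_cast Nat.pos_of_ne_zero hd
  have he' : (0 : ℚ) < e := by exact_mod_cast Nat.pos_of_ne_zero he
  have hneg : ∀ {w w' : ℚ}, e * w = d * w' → w < 0 → w' < 0 := by
    intro w w' h h1
    by_contra! h2
    nlinarith [mul_nonneg hd'.le h2, mul_neg_of_pos_of_neg he' h1]
  have hzero : ∀ {H : (HahnSeries ℚ ℂ)[X]} {s w : ℚ}, 0 ≤ (H.coeff 0).orderTop → w < 0 →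
      (initialForm H s w).coeff 0 = 0 := by
    intro H s w h0 h1
    rw [coeff_initialForm]
    exact le_orderTop_iff_forall.1 h0 _ (by simpa using WithTop.coe_lt_coe.2 h1)
  -- The induction runs on the degree of the vertex about which the supporting line of `F` turns
  -- next.
  induction hk : (initialForm F s w).natTrailingDegree using Nat.strong_induction_on
    generalizing s w w' with
  | _ k ih =>
  obtain ⟨htr, hco⟩ := trailing_of_pow_mul_eq hp hq hA hB hpq
  rw [hk] at htr
  set l := (initialForm G s w').natTrailingDegree with hl
  have hpk : (initialForm F s w).coeff k = (initialForm F s w).trailingCoeff := by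
    rw [trailingCoeff, hk]
  have hql : (initialForm G s w').coeff l = (initialForm G s w').trailingCoeff := by
    rw [trailingCoeff, hl]
  have hpk0 : (initialForm F s w).coeff k ≠ 0 := by
    rw [hpk]; exact trailingCoeff_nonzero_iff_nonzero.2 hp
  have hql0 : (initialForm G s w').coeff l ≠ 0 := by
    rw [hql]; exact trailingCoeff_nonzero_iff_nonzero.2 hq
  have hk0 : k ≠ 0 := by
    rintro rfl
    exact hpk0 (hzero hF0 hw)
  have hk' : (0 : ℚ) < k := by exact_mod_cast Nat.pos_of_ne_zero hk0
  have htr' : (e : ℚ) * k = d * l := by exact_mod_cast htr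
  -- The bound `-w / k` is the turn at which the weight `w + k ρ` reaches zero.
  obtain ⟨ρ, hρ, hρle, hF1, hG1, hbr⟩ := exists_common_break hF hG
    (fun i hi => coeff_eq_zero_of_lt_natTrailingDegree (hi.trans_eq hk.symm))
    (fun i hi => coeff_eq_zero_of_lt_natTrailingDegree (hi.trans_eq hl))
    (div_pos (neg_pos.2 hw) hk')
  have hdp := hF.natDegree_initialForm_add hpk0 hρ
  have hdq := hG.natDegree_initialForm_add hql0 hρ
  have hlp : (initialForm F (s + ρ) (w + k * ρ)).leadingCoeff =
      (initialForm F s w).trailingCoeff := by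
    rw [Polynomial.leadingCoeff, hdp, coeff_initialForm_add, hpk]
  have hlq : (initialForm G (s + ρ) (w' + l * ρ)).leadingCoeff =
      (initialForm G s w').trailingCoeff := by
    rw [Polynomial.leadingCoeff, hdq, coeff_initialForm_add, hql]
  rw [← hlp, ← hlq] at hco
  have hww1 : e * (w + k * ρ) = d * (w' + l * ρ) := by
    linear_combination hww + ρ * htr'
  rcases hρle.lt_or_eq with hlt | heq
  · have hw1 : w + k * ρ < 0 := by
      rw [lt_div_iff₀ hk'] at hlt
      linarith
    have hw1' := hneg hww1 hw1
    set p := initialForm F (s + ρ) (w + k * ρ) with hpdef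
    set q := initialForm G (s + ρ) (w' + l * ρ) with hqdef
    have hp1 : p ≠ 0 := by
      intro h
      rw [h, natDegree_zero] at hdp
      exact hk0 hdp.symm
    have hq1 : q ≠ 0 := by
      intro h
      have := congrArg (fun f => Polynomial.coeff f l) h
      rw [hqdef] at this
      simp only [coeff_initialForm_add] at this
      exact hql0 this
    obtain ⟨c, hc⟩ := hW _ _ _ hF1 hG1
    -- Negative weights exclude constant terms in `p` and `q`, so the Wronskian vanishes at `ξ = 0`.
    have hc0 : c = 0 := by
      have := congrArg (fun f => Polynomial.coeff f 0) hc
      simp only [Polynomial.coeff_sub, mul_coeff_zero, hzero hF0 hw1,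
        hzero hG0 hw1', Polynomial.coeff_C_zero] at this
      simpa using this.symm
    rw [hc0, map_zero, sub_eq_zero] at hc
    have hODE : Polynomial.C (d : ℂ) * (p * derivative q) =
        Polynomial.C (e : ℂ) * (derivative p * q) := by
      have hne : Polynomial.C ((w' + l * ρ : ℚ) : ℂ) ≠ 0 := by
        rw [Polynomial.C_ne_zero]
        exact_mod_cast hw1'.ne
      have hC : Polynomial.C (e : ℂ) * Polynomial.C ((w + k * ρ : ℚ) : ℂ) =
          Polynomial.C (d : ℂ) * Polynomial.C ((w' + l * ρ : ℚ) : ℂ) := by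
        rw [← Polynomial.C_mul, ← Polynomial.C_mul]
        congr 1
        exact_mod_cast hww1
      apply mul_left_cancel₀ hne
      linear_combination Polynomial.C (e : ℂ) * hc - p * derivative q * hC
    have hpq1 := pow_mul_eq_of_derivative hp1 hq1 hA hB hODE hco
    refine ih _ ?_ hF1 hG1 hw1 hww1 hp1 hq1 hpq1 rfl
    have htr1 := (trailing_of_pow_mul_eq hp1 hq1 hA hB hpq1).1
    -- The least degrees keep the ratio `d : e`, so a break in either polygon lowers the vertex of
    -- `F`.
    rcases hbr hlt with ⟨i, hi, hi0⟩ | ⟨i, hi, hi0⟩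
    · exact (natTrailingDegree_le_of_ne_zero hi0).trans_lt hi
    · have h1 := (natTrailingDegree_le_of_ne_zero hi0).trans_lt hi
      have h2 : d * q.natTrailingDegree < d * l :=
        Nat.mul_lt_mul_of_pos_left h1 (Nat.pos_of_ne_zero hd)
      rw [← htr, ← htr1] at h2
      exact lt_of_mul_lt_mul_left h2 (Nat.zero_le _)
  -- The turn goes all the way; the weights are proportional, so both vanish at the same slope.
  · have hw1 : w + k * ρ = 0 := by
      rw [heq]; field_simp; ring
    have hw1' : w' + l * ρ = 0 := by
      rw [hw1, mul_zero] at hww1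
      exact (mul_eq_zero.1 hww1.symm).resolve_left hd'.ne'
    rw [hw1] at hF1 hdp hlp hco
    rw [hw1'] at hG1 hdq hlq hco
    exact ⟨s + ρ, hF1, hG1, by rwa [hdp], by rw [hdp, hdq, htr], hco⟩

theorem exists_similarAtInfinity {M N : ℕ} (hd : d ≠ 0) (he : e ≠ 0) (hA : A ≠ 0) (hB : B ≠ 0)
    (hF0 : 0 ≤ (F.coeff 0).orderTop) (hG0 : 0 ≤ (G.coeff 0).orderTop)
    (hW : ∀ s w w', HasWeight F s w → HasWeight G s w' → ∃ c : ℂ,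
      Polynomial.C (w : ℂ) * (initialForm F s w * derivative (initialForm G s w')) -
        Polynomial.C (w' : ℂ) * (derivative (initialForm F s w) * initialForm G s w') =
          Polynomial.C c)
    (hM : F.natDegree ≤ M) (hFA : F.coeff M = C A) (hN : G.natDegree ≤ N) (hGB : G.coeff N = C B)
    (hMN : e * M = d * N) (hM0 : M ≠ 0) :
    ∃ r, HasWeight F r 0 ∧ HasWeight G r 0 ∧
      SimilarAtInfinity d e A B (initialForm F r 0) (initialForm G r 0) := by
  obtain ⟨s, ⟨⟨hF, hp⟩, hG, hq⟩, hs⟩ := (((eventually_atBot_hasWeight hM hFA).and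
    (eventually_atBot_hasWeight hN hGB)).and (eventually_lt_atBot 0)).exists
  have hM' : (0 : ℚ) < M := by exact_mod_cast Nat.pos_of_ne_zero hM0
  refine exists_similarAtInfinity_of_pow_mul_eq hd he hA hB hF0 hG0 hW hF hG
    (mul_neg_of_pos_of_neg hM' hs) ?_ ?_ ?_ ?_
  · have : (e : ℚ) * M = d * N := by exact_mod_cast hMN
    linear_combination s * this
  · rw [hp]; simpa using hA
  · rw [hq]; simpa using hB
  · rw [hp, hq, monomial_pow, monomial_pow, monomial_mul_C, C_mul_monomial, mul_comm M,
      mul_comm N, hMN, mul_comm]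

end Descent

end HahnSeries

/-! ### Restriction of a bivariate polynomial to the vertical line over a point -/

section VerticalSlice

variable {S T : Type*} [CommRing S] [Algebra ℂ S] [CommRing T] [Algebra ℂ T]

/-- The polynomial `P(a, Y)` in `Y`. -/
noncomputable def verticalSlice (P : MvPolynomial (Fin 2) ℂ) (a : S) : S[X] :=
  MvPolynomial.aeval ![C a, X] P

theorem eval_verticalSlice (P : MvPolynomial (Fin 2) ℂ) (a y : S) :
    (verticalSlice P a).eval y = MvPolynomial.aeval ![a, y] P := by
  rw [verticalSlice]
  induction P using MvPolynomial.induction_on with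
  | C c => simp [Polynomial.algebraMap_apply]
  | add p q hp hq => simp only [map_add, eval_add, hp, hq]
  | mul_X p i hp =>
    simp only [map_mul, eval_mul, hp, MvPolynomial.aeval_X]
    fin_cases i <;> simp

theorem map_verticalSlice (P : MvPolynomial (Fin 2) ℂ) (f : S →ₐ[ℂ] T) (a : S) :
    (verticalSlice P a).map (f : S →+* T) = verticalSlice P (f a) := by
  rw [verticalSlice, verticalSlice]
  induction P using MvPolynomial.induction_on with
  | C c => simp [Polynomial.algebraMap_apply]
  | add p q hp hq => simp only [map_add, Polynomial.map_add, hp, hq]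
  | mul_X p i hp =>
    simp only [map_mul, Polynomial.map_mul, hp, MvPolynomial.aeval_X]
    fin_cases i <;> simp

theorem coeff_verticalSlice (P : MvPolynomial (Fin 2) ℂ) (a : S) (n : ℕ) :
    (verticalSlice P a).coeff n =
      ∑ m ∈ P.support, if m 1 = n then algebraMap ℂ S (P.coeff m) * a ^ m 0 else 0 := by
  rw [verticalSlice, MvPolynomial.aeval_def, MvPolynomial.eval₂_eq', finsetSum_coeff]
  refine Finset.sum_congr rfl fun m _ => ?_
  rw [Fin.prod_univ_two]
  simp only [Matrix.cons_val_zero, Matrix.cons_val_one, Polynomial.algebraMap_apply]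
  rw [← mul_assoc, ← C_pow, ← C_mul, coeff_C_mul, coeff_X_pow]
  simp [eq_comm]

theorem apply_add_apply_le_totalDegree {P : MvPolynomial (Fin 2) ℂ} {m : Fin 2 →₀ ℕ}
    (hm : m ∈ P.support) : m 0 + m 1 ≤ P.totalDegree := by
  have h := MvPolynomial.le_totalDegree hm
  rwa [Finsupp.sum_fintype _ _ (fun _ => rfl), Fin.sum_univ_two] at h

theorem natDegree_verticalSlice_le {P : MvPolynomial (Fin 2) ℂ} {N : ℕ} (hP : P.totalDegree ≤ N)
    (a : S) : (verticalSlice P a).natDegree ≤ N := by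
  rw [natDegree_le_iff_coeff_eq_zero]
  intro n hn
  rw [coeff_verticalSlice]
  refine Finset.sum_eq_zero fun m hm => if_neg fun h => ?_
  have := apply_add_apply_le_totalDegree hm
  omega

theorem coeff_verticalSlice_totalDegree {P : MvPolynomial (Fin 2) ℂ} {N : ℕ}
    (hP : P.totalDegree ≤ N) (a : S) :
    (verticalSlice P a).coeff N = algebraMap ℂ S (P.coeff (Finsupp.single 1 N)) := by
  rw [coeff_verticalSlice]
  rw [Finset.sum_eq_single (Finsupp.single 1 N)]
  · simp
  · intro m hm hne
    refine if_neg fun h => hne ?_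
    have := apply_add_apply_le_totalDegree hm
    ext i
    fin_cases i
    · simp; omega
    · simpa using h
  · intro h
    simp [MvPolynomial.notMem_support_iff.1 h]

end VerticalSlice

/-! ### The chain rule for the Jacobian determinant -/

section ChainRule

variable {S : Type*} [CommRing S] [Algebra ℂ S]

theorem map_aeval_of_leibniz (D : S →+ S) (hmul : ∀ x y, D (x * y) = x * D y + y * D x)
    (hC : ∀ c : ℂ, D (algebraMap ℂ S c) = 0) (g : Fin 2 → S) (P : MvPolynomial (Fin 2) ℂ) :
    D (MvPolynomial.aeval g P) =
      MvPolynomial.aeval g (MvPolynomial.pderiv 0 P) * D (g 0) +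
        MvPolynomial.aeval g (MvPolynomial.pderiv 1 P) * D (g 1) := by
  induction P using MvPolynomial.induction_on with
  | C c => simp [hC]
  | add p q hp hq => simp only [map_add, hp, hq]; ring
  | mul_X p i hp =>
    simp only [map_mul, hmul, hp, Derivation.leibniz, MvPolynomial.aeval_X, smul_eq_mul, map_add]
    fin_cases i <;> simp [MvPolynomial.pderiv_X] <;> ring

theorem jacobian_aeval_of_leibniz (D E : S →+ S) (hD : ∀ x y, D (x * y) = x * D y + y * D x)
    (hDC : ∀ c : ℂ, D (algebraMap ℂ S c) = 0) (hE : ∀ x y, E (x * y) = x * E y + y * E x)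
    (hEC : ∀ c : ℂ, E (algebraMap ℂ S c) = 0) (g : Fin 2 → S) (P Q : MvPolynomial (Fin 2) ℂ) :
    D (MvPolynomial.aeval g P) * E (MvPolynomial.aeval g Q) -
      E (MvPolynomial.aeval g P) * D (MvPolynomial.aeval g Q) =
    MvPolynomial.aeval g (jacobianDet P Q) * (D (g 0) * E (g 1) - E (g 0) * D (g 1)) := by
  rw [map_aeval_of_leibniz D hD hDC, map_aeval_of_leibniz E hE hEC,
    map_aeval_of_leibniz D hD hDC, map_aeval_of_leibniz E hE hEC, jacobianDet]
  simp only [map_sub, map_mul]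
  ring

end ChainRule

/-! ### The Jacobian condition as a Wronskian identity for initial forms -/

namespace HahnSeries

theorem algebraMap_eq_single {R : Type*} [CommRing R] [Algebra ℂ R] (c : ℂ) :
    algebraMap ℂ (HahnSeries ℚ R) c = single 0 (algebraMap ℂ R c) := by
  rw [algebraMap_apply', PowerSeries.algebraMap_apply, ofPowerSeries_C, C_apply]

theorem euler_algebraMap {R : Type*} [CommRing R] [Algebra ℂ R] (c : ℂ) :
    euler R (algebraMap ℂ (HahnSeries ℚ R) c) = 0 := by
  rw [algebraMap_eq_single, euler_single]
  simp

theorem coeffDerivation_algebraMap {R : Type*} [CommRing R] [Algebra ℂ R] (D : Derivation ℂ R R)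
    (c : ℂ) : coeffDerivation D (algebraMap ℂ (HahnSeries ℚ R) c) = 0 := by
  rw [algebraMap_eq_single, coeffDerivation_single]
  simp

/-- The coordinate `x = t⁻¹` at infinity. -/
noncomputable def coordX : HahnSeries ℚ ℂ := single (-1) 1

theorem rescale_taylor_verticalSlice (P : MvPolynomial (Fin 2) ℂ) (a φ : HahnSeries ℚ ℂ) (s : ℚ) :
    rescale s ((verticalSlice P a).taylor φ) = MvPolynomial.aeval
      ![coeffRingHom Polynomial.C a, single s X + coeffRingHom Polynomial.C φ] P := by
  have hC : ∀ x : HahnSeries ℚ ℂ, rescale s (Polynomial.C x) = coeffRingHom Polynomial.C x := by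
    intro x
    simp [rescale]
  have hX : rescale s (X : (HahnSeries ℚ ℂ)[X]) = single s X := by simp [rescale]
  rw [verticalSlice]
  induction P using MvPolynomial.induction_on with
  | C c =>
    rw [MvPolynomial.aeval_C, MvPolynomial.aeval_C, Polynomial.algebraMap_apply, taylor_C, hC,
      algebraMap_eq_single, algebraMap_eq_single, coeffRingHom_single]
    rfl
  | add p q hp hq => simp only [map_add, hp, hq]
  | mul_X p i hp =>
    simp only [map_mul, taylor_mul, hp, MvPolynomial.aeval_X]
    fin_cases i
    · simp [hC]
    · simp [hC, hX]

/-- Let `θ = t d/dt` and `δ = d/dξ`. By the chain rule, `θF δG - δF θG` for the rescaled series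
equals `j θ(x) δ(y) = -j t ^ (s - 1)`, whose coefficients are free of `ξ`. The Wronskian is the
coefficient of `t ^ (w + w')` on the left. -/
theorem initialForm_wronskian {P Q : MvPolynomial (Fin 2) ℂ} {j : ℂ}
    (hJ : jacobianDet P Q = MvPolynomial.C j) (φ : HahnSeries ℚ ℂ) {s w w' : ℚ}
    (hF : HasWeight ((verticalSlice P coordX).taylor φ) s w)
    (hG : HasWeight ((verticalSlice Q coordX).taylor φ) s w') :
    ∃ c : ℂ, Polynomial.C (w : ℂ) * (initialForm ((verticalSlice P coordX).taylor φ) s w *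
        derivative (initialForm ((verticalSlice Q coordX).taylor φ) s w')) -
      Polynomial.C (w' : ℂ) * (derivative (initialForm ((verticalSlice P coordX).taylor φ) s w) *
        initialForm ((verticalSlice Q coordX).taylor φ) s w') = Polynomial.C c := by
  set F := rescale s ((verticalSlice P coordX).taylor φ) with hFdef
  set G := rescale s ((verticalSlice Q coordX).taylor φ) with hGdef
  let θ := euler ℂ[X]
  let δ := coeffDerivation (R := ℂ[X]) derivative'
  have hθ : ∀ {x : HahnSeries ℚ ℂ[X]} {a : ℚ}, a ≤ x.orderTop → a ≤ (θ x).orderTop := by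
    intro x a h
    rw [le_orderTop_iff_forall] at h ⊢
    intro q hq
    rw [coeff_euler, h q hq, smul_zero]
  have hδ : ∀ {x : HahnSeries ℚ ℂ[X]} {a : ℚ}, a ≤ x.orderTop → a ≤ (δ x).orderTop := by
    intro x a h
    rw [le_orderTop_iff_forall] at h ⊢
    intro q hq
    rw [coeff_coeffDerivation, h q hq, map_zero]
  have hFw := hF.le_orderTop_rescale
  have hGw := hG.le_orderTop_rescale
  have hjac := jacobian_aeval_of_leibniz θ δ euler_mul euler_algebraMap
    (coeffDerivation_mul _) (coeffDerivation_algebraMap _)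
    ![coeffRingHom Polynomial.C coordX, single s X + coeffRingHom Polynomial.C φ] P Q
  rw [← rescale_taylor_verticalSlice, ← rescale_taylor_verticalSlice, ← hFdef, ← hGdef, hJ] at hjac
  have h0 : θ (coeffRingHom Polynomial.C coordX) = single (-1) (-1) := by
    simp only [θ, coordX, coeffRingHom_single, euler_single]
    simp
  have h1 : δ (coeffRingHom Polynomial.C coordX) = 0 := by
    ext1; ext1 q
    simp [δ]
  have h2 : δ (single s X + coeffRingHom Polynomial.C φ) = single s 1 := by
    have : δ (coeffRingHom Polynomial.C φ) = 0 := by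
      ext1; ext1 q
      simp [δ]
    rw [map_add, this]
    simp [δ]
  simp only [Matrix.cons_val_zero, Matrix.cons_val_one, h0, h1, h2, MvPolynomial.aeval_C] at hjac
  have hco := congrArg (fun z => HahnSeries.coeff z (w + w')) hjac
  simp only [coeff_sub] at hco
  rw [coeff_mul_of_le_orderTop (hθ hFw) (hδ hGw), coeff_mul_of_le_orderTop (hδ hFw) (hθ hGw),
    zero_mul, sub_zero, single_mul_single, algebraMap_eq_single, single_mul_single] at hco
  obtain ⟨c, hc⟩ : ∃ c : ℂ, (single (0 + (-1 + s)) (algebraMap ℂ ℂ[X] j * (-1 * 1))).coeff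
      (w + w') = Polynomial.C c := by
    rw [coeff_single]
    split_ifs
    · exact ⟨-j, by simp⟩
    · exact ⟨0, by simp⟩
  refine ⟨c, ?_⟩
  rw [← hc, ← hco]
  simp only [θ, δ, coeff_euler, coeff_coeffDerivation, initialForm, ← hFdef, ← hGdef,
    Polynomial.smul_eq_C_mul]
  simp only [derivative'_apply]
  ring

theorem coeff_zero_taylor_verticalSlice (P : MvPolynomial (Fin 2) ℂ) (a φ : HahnSeries ℚ ℂ) :
    ((verticalSlice P a).taylor φ).coeff 0 = MvPolynomial.aeval ![a, φ] P := by
  rw [taylor_coeff_zero, eval_verticalSlice]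

theorem coeff_taylor_of_natDegree_le {R : Type*} [CommRing R] {f : R[X]} {N : ℕ}
    (hN : f.natDegree ≤ N) (r : R) : (f.taylor r).coeff N = f.coeff N := by
  rcases hN.lt_or_eq with h | h
  · rw [Polynomial.coeff_eq_zero_of_natDegree_lt h,
      Polynomial.coeff_eq_zero_of_natDegree_lt (by rwa [natDegree_taylor])]
  · subst h
    exact coeff_taylor_natDegree r f

end HahnSeries

/-! ### Finitely many curves contain the limits along arcs -/

namespace HahnSeries

theorem coeff_pow_of_le_orderTop {R : Type*} [CommRing R] {x : HahnSeries ℚ R} {a : ℚ}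
    (hx : a ≤ x.orderTop) (n : ℕ) : (x ^ n).coeff (n * a) = x.coeff a ^ n := by
  induction n with
  | zero => simp
  | succ n ih =>
    have := coeff_mul_of_le_orderTop (le_orderTop_pow hx n) hx
    rw [pow_succ, pow_succ, ← ih, ← this]
    congr 1
    push_cast
    ring

/-- Moving the centre within the ball of radius `s` only translates the initial form. -/
theorem HasWeight.initialForm_taylor {k : Type*} [Field k] {F : (HahnSeries ℚ k)[X]} {s w : ℚ}
    (h : HasWeight F s w) {δ : HahnSeries ℚ k} (hδ : s ≤ δ.orderTop) :
    initialForm (F.taylor δ) s w = (initialForm F s w).taylor (δ.coeff s) := by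
  ext n
  set N := max F.natDegree (initialForm F s w).natDegree + 1 with hN
  have h1 : (hasseDeriv n F).natDegree < N :=
    lt_of_le_of_lt (natDegree_hasseDeriv_le F n) (by omega)
  have h2 : (hasseDeriv n (initialForm F s w)).natDegree < N :=
    lt_of_le_of_lt (natDegree_hasseDeriv_le _ n) (by omega)
  rw [coeff_initialForm, taylor_coeff, taylor_coeff, eval_eq_sum_range' h1, eval_eq_sum_range' h2,
    coeff_sum]
  refine Finset.sum_congr rfl fun i _ => ?_
  have h3 := coeff_mul_of_le_orderTop (h (i + n)) (le_orderTop_pow hδ i)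
  have h4 : w - ((i + n : ℕ) : ℚ) * s + i * s = w - n * s := by push_cast; ring
  rw [h4, coeff_pow_of_le_orderTop hδ] at h3
  rw [hasseDeriv_coeff, hasseDeriv_coeff, mul_assoc, ← nsmul_eq_mul ((i + n).choose n),
    coeff_nsmul, Pi.smul_apply, h3, coeff_initialForm, nsmul_eq_mul, mul_assoc]

theorem orderTop_eval_eq {f : (HahnSeries ℚ ℂ)[X]} {x y : HahnSeries ℚ ℂ}
    (h : ∀ z ∈ f.roots, (x - z).orderTop = (y - z).orderTop) :
    (f.eval x).orderTop = (f.eval y).orderTop := by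
  have key : ∀ m : Multiset (HahnSeries ℚ ℂ), (∀ z ∈ m, (x - z).orderTop = (y - z).orderTop) →
      ((m.map fun z => x - z).prod).orderTop = ((m.map fun z => y - z).prod).orderTop := by
    intro m
    induction m using Multiset.induction_on with
    | empty => simp
    | cons a m ih =>
      intro hm
      rw [Multiset.map_cons, Multiset.map_cons, Multiset.prod_cons, Multiset.prod_cons,
        orderTop_mul, orderTop_mul, hm a (Multiset.mem_cons_self a m),
        ih fun z hz => hm z (Multiset.mem_cons_of_mem hz)]
  have hs := IsAlgClosed.splits f
  rw [hs.eval_eq_prod_roots, hs.eval_eq_prod_roots, orderTop_mul, orderTop_mul, key _ h]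

/-- The order of `f` at a point depends only on its distances to the roots. Without a root in the
ball it would be the same at all points `φ + c t ^ r`; but the coefficient of `t ^ 0` there is
`p(c)`, which vanishes for some `c` and not for others. -/
theorem exists_root_orderTop_le {f : (HahnSeries ℚ ℂ)[X]} {φ : HahnSeries ℚ ℂ} {r : ℚ}
    (h : HasWeight (f.taylor φ) r 0) (hp : (initialForm (f.taylor φ) r 0).natDegree ≠ 0) :
    ∃ y ∈ f.roots, r ≤ (φ - y).orderTop := by
  by_contra! hno
  set p := initialForm (f.taylor φ) r 0 with hpdef
  have hp0 : p ≠ 0 := by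
    rintro h0
    exact hp (by rw [h0, natDegree_zero])
  have hev : ∀ c : ℂ, (f.eval (φ + single r c)).coeff 0 = p.eval c := by
    intro c
    rw [add_comm, ← taylor_eval, ← coeffRingHom_eval_rescale, coeff_coeffRingHom]
    rfl
  have hge : ∀ c : ℂ, 0 ≤ (f.eval (φ + single r c)).orderTop := by
    intro c
    rw [add_comm, ← taylor_eval]
    exact h.le_orderTop_eval orderTop_single_le
  have hord : ∀ c : ℂ, (f.eval (φ + single r c)).orderTop = (f.eval φ).orderTop := by
    intro c
    refine orderTop_eval_eq fun z hz => ?_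
    rw [add_sub_right_comm, orderTop_add_eq_left ((hno z hz).trans_le orderTop_single_le)]
  obtain ⟨c, hc⟩ := IsAlgClosed.exists_root p
    (fun h0 => hp (natDegree_eq_of_degree_eq_some h0))
  obtain ⟨c', hc'⟩ : ∃ c', p.eval c' ≠ 0 := by
    by_contra! hall
    exact hp0 (Polynomial.funext (by simpa using hall))
  have h1 : (f.eval (φ + single r c')).orderTop = 0 := by
    refine le_antisymm ?_ (hge c')
    have := orderTop_le_of_coeff_ne_zero (x := f.eval (φ + single r c')) (g := 0)
      (by rwa [hev])
    simpa using this
  have h2 : (f.eval (φ + single r c)).orderTop ≠ ((0 : ℚ) : WithTop ℚ) :=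
    orderTop_ne_of_coeff_eq_zero (by rw [hev]; exact hc)
  rw [hord] at h1 h2
  exact h2 h1

theorem SimilarAtInfinity.of_taylor {d e : ℕ} {A B : ℂ} {p q : ℂ[X]} {c : ℂ}
    (h : SimilarAtInfinity d e A B (p.taylor c) (q.taylor c)) : SimilarAtInfinity d e A B p q := by
  obtain ⟨h1, h2, h3⟩ := h
  rw [natDegree_taylor] at h1 h2
  rw [natDegree_taylor] at h2
  rw [leadingCoeff_taylor, leadingCoeff_taylor] at h3
  exact ⟨h1, h2, h3⟩

theorem SimilarAtInfinity.symm {d e : ℕ} {A B : ℂ} {p q : ℂ[X]} (hd : d ≠ 0)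
    (h : SimilarAtInfinity e d B A q p) : SimilarAtInfinity d e A B p q := by
  obtain ⟨h1, h2, h3⟩ := h
  refine ⟨fun h0 => ?_, h2.symm, by rw [mul_comm, ← h3, mul_comm]⟩
  rw [h0, mul_zero] at h2
  exact (mul_ne_zero hd h1) h2

/-- The limits of `(P, Q)` along all Puiseux arcs at infinity lie on finitely many polynomial
curves. -/
theorem exists_finite_curves {P Q : MvPolynomial (Fin 2) ℂ} {j A B : ℂ} {M N d e : ℕ}
    (hJ : jacobianDet P Q = MvPolynomial.C j) (hd : d ≠ 0) (he : e ≠ 0) (hM0 : M ≠ 0)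
    (hMN : e * M = d * N) (hP : P.totalDegree ≤ M) (hQ : Q.totalDegree ≤ N)
    (hA : P.coeff (Finsupp.single 1 M) = A) (hA0 : A ≠ 0)
    (hB : Q.coeff (Finsupp.single 1 N) = B) (hB0 : B ≠ 0) :
    ∃ S : Set (ℂ[X] × ℂ[X]), S.Finite ∧ (∀ c ∈ S, SimilarAtInfinity d e A B c.1 c.2) ∧
      ∀ φ : HahnSeries ℚ ℂ, 0 ≤ (MvPolynomial.aeval ![coordX, φ] P).orderTop →
        0 ≤ (MvPolynomial.aeval ![coordX, φ] Q).orderTop →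
        ∃ c ∈ S, ∃ ξ : ℂ, c.1.eval ξ = (MvPolynomial.aeval ![coordX, φ] P).coeff 0 ∧
          c.2.eval ξ = (MvPolynomial.aeval ![coordX, φ] Q).coeff 0 := by
  classical
  set f := verticalSlice P coordX with hf
  set g := verticalSlice Q coordX with hg
  have hC : ∀ c : ℂ, algebraMap ℂ (HahnSeries ℚ ℂ) c = C c := fun c => algebraMap_eq_single c
  let good : HahnSeries ℚ ℂ → ℚ → Prop := fun y r =>
    HasWeight (f.taylor y) r 0 ∧ HasWeight (g.taylor y) r 0 ∧
      SimilarAtInfinity d e A B (initialForm (f.taylor y) r 0) (initialForm (g.taylor y) r 0)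
  -- If `r' < r`, the weight bound at `r'` pushes all terms of positive degree strictly above weight
  -- zero at `r`, and the form there could not be nonconstant.
  have hle : ∀ y r r', good y r → good y r' → r ≤ r' := by
    rintro y r r' ⟨-, -, h2⟩ ⟨h3, -, -⟩
    by_contra! hlt
    have h4 := h2.natDegree_ne_zero
    have h5 : (initialForm (f.taylor y) r 0).coeff (initialForm (f.taylor y) r 0).natDegree ≠ 0 := by
      rw [coeff_natDegree, Polynomial.leadingCoeff_ne_zero]
      intro h0
      exact h4 (by rw [h0, natDegree_zero])
    rw [coeff_initialForm] at h5
    refine h5 (hasWeight_iff.1 h3 _ _ ?_)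
    have : (0 : ℚ) < (initialForm (f.taylor y) r 0).natDegree := by
      exact_mod_cast Nat.pos_of_ne_zero h4
    nlinarith
  have huniq : ∀ y r r', good y r → good y r' → r = r' := fun y r r' h h' =>
    le_antisymm (hle y r r' h h') (hle y r' r h' h)
  -- Only roots of `P(t⁻¹, Y)`, which do not depend on the arc, serve as centres; this makes the
  -- family finite.
  let S : Set (ℂ[X] × ℂ[X]) := {c | ∃ y ∈ f.roots, ∃ r, good y r ∧
    c = (initialForm (f.taylor y) r 0, initialForm (g.taylor y) r 0)}
  refine ⟨S, ?_, ?_, ?_⟩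
  · let h : HahnSeries ℚ ℂ → ℂ[X] × ℂ[X] := fun y =>
      if hy : ∃ r, good y r then
        (initialForm (f.taylor y) hy.choose 0, initialForm (g.taylor y) hy.choose 0) else 0
    refine (f.roots.toFinset.finite_toSet.image h).subset ?_
    rintro c ⟨y, hy, r, hr, rfl⟩
    refine ⟨y, by simpa using hy, ?_⟩
    have hex : ∃ r, good y r := ⟨r, hr⟩
    simp only [h, dif_pos hex, huniq y _ _ hex.choose_spec hr]
  · rintro c ⟨y, hy, r, hr, rfl⟩
    exact hr.2.2
  · intro φ hφP hφQ
    obtain ⟨r, hr⟩ : ∃ r, good φ r := by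
      refine exists_similarAtInfinity (M := M) (N := N) hd he hA0 hB0 ?_ ?_
        (fun s w w' h h' => initialForm_wronskian hJ φ h h') ?_ ?_ ?_ ?_ hMN hM0
      · rwa [coeff_zero_taylor_verticalSlice]
      · rwa [coeff_zero_taylor_verticalSlice]
      · rw [natDegree_taylor]; exact natDegree_verticalSlice_le hP _
      · rw [coeff_taylor_of_natDegree_le (natDegree_verticalSlice_le hP _),
          coeff_verticalSlice_totalDegree hP, hA, hC]
      · rw [natDegree_taylor]; exact natDegree_verticalSlice_le hQ _
      · rw [coeff_taylor_of_natDegree_le (natDegree_verticalSlice_le hQ _),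
          coeff_verticalSlice_totalDegree hQ, hB, hC]
    obtain ⟨y, hy, hyr⟩ := exists_root_orderTop_le hr.1 hr.2.2.natDegree_ne_zero
    have hyr' : r ≤ (y - φ).orderTop := by rwa [← neg_sub, orderTop_neg]
    have hshift : ∀ F : (HahnSeries ℚ ℂ)[X], (F.taylor φ).taylor (y - φ) = F.taylor y := by
      intro F
      rw [taylor_taylor, sub_add_cancel]
    have hshift' : ∀ F : (HahnSeries ℚ ℂ)[X], (F.taylor y).taylor (φ - y) = F.taylor φ := by
      intro F
      rw [taylor_taylor, sub_add_cancel]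
    have hfy : HasWeight (f.taylor y) r 0 := hshift f ▸ hr.1.taylor hyr'
    have hgy : HasWeight (g.taylor y) r 0 := hshift g ▸ hr.2.1.taylor hyr'
    have hpf := hfy.initialForm_taylor hyr
    have hpg := hgy.initialForm_taylor hyr
    rw [hshift'] at hpf hpg
    -- Recentring from `φ` to `y` translates the forms by the coefficient of `t ^ r` in `φ - y`;
    -- that coefficient is the parameter of the limit.
    refine ⟨_, ⟨y, hy, r, ⟨hfy, hgy, ?_⟩, rfl⟩, (φ - y).coeff r, ?_, ?_⟩
    · apply SimilarAtInfinity.of_taylor (c := (φ - y).coeff r)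
      rw [← hpf, ← hpg]
      exact hr.2.2
    · rw [← taylor_coeff_zero, ← hpf, coeff_initialForm, hf, coeff_zero_taylor_verticalSlice]
      simp
    · rw [← taylor_coeff_zero, ← hpg, coeff_initialForm, hg, coeff_zero_taylor_verticalSlice]
      simp

end HahnSeries

open HahnSeries (coordX euler euler_mul euler_algebraMap euler_single single_eq_zero_iff
  algebraMap_eq_single single_pow single_mul_single coeff_single le_orderTop_iff_forall
  orderTop_le_of_coeff_ne_zero orderTop_mul orderTop_single_le le_orderTop_add)

/-! ### The eliminant of a polynomial map -/

/-- A pair of polynomials with constant nonzero Jacobian determinant, whose terms of highest degree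
contain `A y ^ M` and `B y ^ N`. -/
structure IsKellerPair (P Q : MvPolynomial (Fin 2) ℂ) (M N : ℕ) (A B j : ℂ) : Prop where
  jacobian : jacobianDet P Q = MvPolynomial.C j
  j_ne : j ≠ 0
  M_ne : M ≠ 0
  N_ne : N ≠ 0
  degree_fst : P.totalDegree ≤ M
  degree_snd : Q.totalDegree ≤ N
  coeff_fst : P.coeff (Finsupp.single 1 M) = A
  coeff_snd : Q.coeff (Finsupp.single 1 N) = B
  A_ne : A ≠ 0
  B_ne : B ≠ 0

theorem IsKellerPair.symm {P Q : MvPolynomial (Fin 2) ℂ} {M N : ℕ} {A B j : ℂ}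
    (h : IsKellerPair P Q M N A B j) : IsKellerPair Q P N M B A (-j) where
  jacobian := by
    rw [map_neg, ← h.jacobian, jacobianDet, jacobianDet]
    ring
  j_ne := neg_ne_zero.2 h.j_ne
  M_ne := h.N_ne
  N_ne := h.M_ne
  degree_fst := h.degree_snd
  degree_snd := h.degree_fst
  coeff_fst := h.coeff_snd
  coeff_snd := h.coeff_fst
  A_ne := h.B_ne
  B_ne := h.A_ne

/-- The resultant of `P(x, y) - u` and `Q(x, y) - v` with respect to `y`, as a polynomial in `x`
with coefficients in `ℂ[u, v]`. -/
noncomputable def eliminant (P Q : MvPolynomial (Fin 2) ℂ) (M N : ℕ) :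
    (MvPolynomial (Fin 2) ℂ)[X] :=
  resultant (verticalSlice P (X : (MvPolynomial (Fin 2) ℂ)[X]) - C (C (MvPolynomial.X 0)))
    (verticalSlice Q (X : (MvPolynomial (Fin 2) ℂ)[X]) - C (C (MvPolynomial.X 1))) M N

/-- The eliminant over the point `a`. -/
noncomputable def eliminantAt (P Q : MvPolynomial (Fin 2) ℂ) (M N : ℕ) (a : Fin 2 → ℂ) : ℂ[X] :=
  (eliminant P Q M N).map (MvPolynomial.eval a)

theorem coeff_eliminantAt (P Q : MvPolynomial (Fin 2) ℂ) (M N : ℕ) (a : Fin 2 → ℂ) (i : ℕ) :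
    (eliminantAt P Q M N a).coeff i = MvPolynomial.eval a ((eliminant P Q M N).coeff i) :=
  coeff_map _ _

theorem natDegree_eliminantAt_le (P Q : MvPolynomial (Fin 2) ℂ) (M N : ℕ) (a : Fin 2 → ℂ) :
    (eliminantAt P Q M N a).natDegree ≤ (eliminant P Q M N).natDegree :=
  natDegree_map_le

/-- The size of the Sylvester matrix is fixed by `M` and `N`, so the resultant commutes with every
specialization, including those into Hahn series. -/
theorem aeval_eliminantAt (P Q : MvPolynomial (Fin 2) ℂ) (M N : ℕ) (a : Fin 2 → ℂ)
    {T : Type*} [CommRing T] [Algebra ℂ T] (x : T) :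
    aeval x (eliminantAt P Q M N a) =
      resultant (verticalSlice P x - C (algebraMap ℂ T (a 0)))
        (verticalSlice Q x - C (algebraMap ℂ T (a 1))) M N := by
  let σ : (MvPolynomial (Fin 2) ℂ)[X] →ₐ[ℂ] T :=
    (aeval x).comp (mapAlgHom (MvPolynomial.aeval a))
  have hσ : ∀ r, σ r = aeval x (r.map (MvPolynomial.eval a)) := fun r => rfl
  have hX : σ X = x := by simp [hσ]
  have hC : ∀ i, σ (C (MvPolynomial.X i)) = algebraMap ℂ T (a i) := by
    intro i
    simp [hσ]
  have hmap : ∀ (F : MvPolynomial (Fin 2) ℂ) (i : Fin 2),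
      (verticalSlice F (X : (MvPolynomial (Fin 2) ℂ)[X]) - C (C (MvPolynomial.X i))).map
        (σ : (MvPolynomial (Fin 2) ℂ)[X] →+* T) =
      verticalSlice F x - C (algebraMap ℂ T (a i)) := by
    intro F i
    rw [Polynomial.map_sub, map_verticalSlice, hX, Polynomial.map_C, RingHom.coe_coe, hC]
  rw [eliminantAt, ← hσ, eliminant, ← hmap, ← hmap, resultant_map_map]
  rfl

namespace IsKellerPair

variable {P Q : MvPolynomial (Fin 2) ℂ} {M N : ℕ} {A B j : ℂ}

theorem natDegree_slice (h : IsKellerPair P Q M N A B j) {T : Type*} [Field T] [Algebra ℂ T]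
    (x c : T) : (verticalSlice P x - C c).natDegree = M ∧
      (verticalSlice P x - C c).leadingCoeff = algebraMap ℂ T A := by
  have h1 : (verticalSlice P x - C c).coeff M = algebraMap ℂ T A := by
    rw [coeff_sub, coeff_verticalSlice_totalDegree h.degree_fst, h.coeff_fst, coeff_C,
      if_neg h.M_ne, sub_zero]
  have h2 : (verticalSlice P x - C c).natDegree = M := by
    refine natDegree_eq_of_le_of_coeff_ne_zero ?_ ?_
    · refine (natDegree_sub_le _ _).trans (max_le (natDegree_verticalSlice_le h.degree_fst x) ?_)
      simp
    · rw [h1]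
      exact (_root_.map_ne_zero _).2 h.A_ne
  exact ⟨h2, by rw [leadingCoeff, h2, h1]⟩

theorem aeval_eliminantAt_eq_prod (h : IsKellerPair P Q M N A B j) (a : Fin 2 → ℂ)
    {T : Type*} [Field T] [Algebra ℂ T] [IsAlgClosed T] (x : T) :
    aeval x (eliminantAt P Q M N a) = algebraMap ℂ T A ^ N *
      ((verticalSlice P x - C (algebraMap ℂ T (a 0))).roots.map fun y =>
        MvPolynomial.aeval ![x, y] Q - algebraMap ℂ T (a 1)).prod := by
  obtain ⟨h1, h2⟩ := h.natDegree_slice x (algebraMap ℂ T (a 0))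
  have h3 : (verticalSlice Q x - C (algebraMap ℂ T (a 1))).natDegree ≤ N :=
    (h.symm.natDegree_slice x _).1.le
  have h4 := resultant_eq_prod_eval _ _ N h3
    (IsAlgClosed.splits (verticalSlice P x - C (algebraMap ℂ T (a 0))))
  rw [h1, h2] at h4
  rw [aeval_eliminantAt, h4]
  congr 3
  ext y
  rw [eval_sub, eval_C, eval_verticalSlice]

theorem mem_roots_slice (h : IsKellerPair P Q M N A B j) {T : Type*} [Field T] [Algebra ℂ T]
    (x c y : T) : y ∈ (verticalSlice P x - C c).roots ↔ MvPolynomial.aeval ![x, y] P = c := by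
  have h0 : verticalSlice P x - C c ≠ 0 := by
    intro h0
    have := (h.natDegree_slice x c).1
    rw [h0, natDegree_zero] at this
    exact h.M_ne this.symm
  rw [mem_roots h0, IsRoot, eval_sub, eval_C, eval_verticalSlice, sub_eq_zero]

theorem aeval_eliminantAt_eq_zero_iff (h : IsKellerPair P Q M N A B j) (a : Fin 2 → ℂ)
    {T : Type*} [Field T] [Algebra ℂ T] [IsAlgClosed T] (x : T) :
    aeval x (eliminantAt P Q M N a) = 0 ↔ ∃ y, MvPolynomial.aeval ![x, y] P =
      algebraMap ℂ T (a 0) ∧ MvPolynomial.aeval ![x, y] Q = algebraMap ℂ T (a 1) := by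
  rw [h.aeval_eliminantAt_eq_prod, mul_eq_zero,
    or_iff_right (pow_ne_zero _ ((_root_.map_ne_zero _).2 h.A_ne)), Multiset.prod_eq_zero_iff,
    Multiset.mem_map]
  simp only [h.mem_roots_slice, sub_eq_zero]

/-- If it vanished, evaluation at `x = t⁻¹` would give an arc along which `P` and `Q` are both
constant. Applying `t d/dt` and eliminating the derivative of `y` leaves `j · t d(t⁻¹)/dt = 0`. -/
theorem eliminantAt_ne_zero (h : IsKellerPair P Q M N A B j) (a : Fin 2 → ℂ) :
    eliminantAt P Q M N a ≠ 0 := by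
  intro h0
  obtain ⟨y, hP, hQ⟩ := (h.aeval_eliminantAt_eq_zero_iff a coordX).1 (by rw [h0, map_zero])
  have h1 := map_aeval_of_leibniz (euler ℂ) euler_mul euler_algebraMap ![coordX, y] P
  have h2 := map_aeval_of_leibniz (euler ℂ) euler_mul euler_algebraMap ![coordX, y] Q
  rw [hP, euler_algebraMap] at h1
  rw [hQ, euler_algebraMap] at h2
  have h3 := congrArg (MvPolynomial.aeval ![coordX, y]) h.jacobian
  rw [jacobianDet, map_sub, map_mul, map_mul, MvPolynomial.aeval_C] at h3
  simp only [Matrix.cons_val_zero, Matrix.cons_val_one] at h1 h2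
  have h4 : algebraMap ℂ (HahnSeries ℚ ℂ) j * euler ℂ coordX = 0 := by
    rw [← h3]
    linear_combination
      MvPolynomial.aeval ![coordX, y] (MvPolynomial.pderiv 1 P) * h2 -
        MvPolynomial.aeval ![coordX, y] (MvPolynomial.pderiv 1 Q) * h1
  rcases mul_eq_zero.1 h4 with h5 | h5
  · exact h.j_ne ((map_eq_zero _).1 h5)
  · rw [coordX, euler_single] at h5
    have := single_eq_zero_iff.1 h5
    simp at this

theorem eliminant_ne_zero (h : IsKellerPair P Q M N A B j) : eliminant P Q M N ≠ 0 := by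
  intro h0
  exact h.eliminantAt_ne_zero 0 (by rw [eliminantAt, h0, Polynomial.map_zero])

theorem eval_polyMap_eliminantAt (h : IsKellerPair P Q M N A B j) (z : Fin 2 → ℂ) :
    (eliminantAt P Q M N (polyMap P Q z)).eval (z 0) = 0 := by
  have hz : ![z 0, z 1] = z := by ext i; fin_cases i <;> rfl
  have := (h.aeval_eliminantAt_eq_zero_iff (polyMap P Q z) (z 0)).2
    ⟨z 1, by simp [hz, polyMap, MvPolynomial.aeval_eq_eval],
      by simp [hz, polyMap, MvPolynomial.aeval_eq_eval]⟩
  simpa using this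

theorem exists_polyMap_eq (h : IsKellerPair P Q M N A B j) {a : Fin 2 → ℂ} {x : ℂ}
    (hx : (eliminantAt P Q M N a).eval x = 0) : ∃ z, z 0 = x ∧ polyMap P Q z = a := by
  obtain ⟨y, h1, h2⟩ := (h.aeval_eliminantAt_eq_zero_iff a x).1 (by simpa using hx)
  refine ⟨![x, y], rfl, ?_⟩
  ext i
  fin_cases i
  · simpa [polyMap, MvPolynomial.aeval_eq_eval] using h1
  · simpa [polyMap, MvPolynomial.aeval_eq_eval] using h2

end IsKellerPair

/-! ### Puiseux arcs through the non-proper values -/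

theorem coeff_aeval_coordX (r : ℂ[X]) (q : ℚ) :
    (aeval coordX r).coeff q =
      ∑ i ∈ Finset.range (r.natDegree + 1), if q = -(i : ℚ) then r.coeff i else 0 := by
  rw [aeval_def, eval₂_eq_sum_range, HahnSeries.coeff_sum]
  refine Finset.sum_congr rfl fun i _ => ?_
  rw [algebraMap_eq_single, coordX, single_pow, single_mul_single, coeff_single]
  simp

theorem neg_natDegree_le_orderTop_aeval_coordX (r : ℂ[X]) :
    ((-(r.natDegree : ℚ) : ℚ) : WithTop ℚ) ≤ (aeval coordX r).orderTop := by
  rw [le_orderTop_iff_forall]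
  intro q hq
  rw [coeff_aeval_coordX]
  refine Finset.sum_eq_zero fun i hi => if_neg ?_
  rintro rfl
  have h1 : (i : ℚ) ≤ r.natDegree := by
    exact_mod_cast Nat.lt_succ_iff.1 (Finset.mem_range.1 hi)
  have := WithTop.coe_lt_coe.1 hq
  linarith

theorem orderTop_aeval_coordX_le {r : ℂ[X]} {n : ℕ} (hn : r.coeff n ≠ 0) :
    (aeval coordX r).orderTop ≤ ((-(n : ℚ) : ℚ) : WithTop ℚ) := by
  apply orderTop_le_of_coeff_ne_zero
  rw [coeff_aeval_coordX, Finset.sum_eq_single n]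
  · simpa using hn
  · intro i _ hi
    refine if_neg fun h => hi ?_
    have : (n : ℚ) = i := neg_injective h
    exact_mod_cast this.symm
  · intro hi
    exact absurd (Finset.mem_range.2 (Nat.lt_succ_of_le (le_natDegree_of_ne_zero hn))) hi

theorem orderTop_prod_le {ι : Type*} (m : Multiset ι) {f g : ι → HahnSeries ℚ ℂ}
    (h : ∀ i ∈ m, (f i).orderTop ≤ (g i).orderTop) :
    (m.map f).prod.orderTop ≤ (m.map g).prod.orderTop := by
  induction m using Multiset.induction_on with
  | empty => simp
  | cons a m ih =>
    rw [Multiset.map_cons, Multiset.map_cons, Multiset.prod_cons, Multiset.prod_cons,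
      orderTop_mul, orderTop_mul]
    exact add_le_add (h a (Multiset.mem_cons_self a m))
      (ih fun i hi => h i (Multiset.mem_cons_of_mem hi))

/-- The eliminant at `t⁻¹` has order minus its degree in `x`, and the degree over `(u, v)` is
smaller than over `(u, v')`. It is also, up to a constant, the product of `Q - v` over the arcs with
`P = u`; if no factor had positive order, replacing `v` by `v'` could not lower the order. -/
theorem IsKellerPair.exists_arc {P Q : MvPolynomial (Fin 2) ℂ} {M N : ℕ} {A B j : ℂ}
    (h : IsKellerPair P Q M N A B j) {u v v' : ℂ}
    (h0 : MvPolynomial.eval ![u, v] (eliminant P Q M N).leadingCoeff = 0)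
    (h1 : MvPolynomial.eval ![u, v'] (eliminant P Q M N).leadingCoeff ≠ 0) :
    ∃ φ : HahnSeries ℚ ℂ, MvPolynomial.aeval ![coordX, φ] P = algebraMap ℂ _ u ∧
      0 < (MvPolynomial.aeval ![coordX, φ] Q - algebraMap ℂ _ v).orderTop := by
  by_contra! hno
  set n := (eliminant P Q M N).natDegree with hn
  have hlt : (eliminantAt P Q M N ![u, v]).natDegree < n := by
    refine lt_of_le_of_ne (natDegree_eliminantAt_le ..) fun heq => ?_
    have : (eliminantAt P Q M N ![u, v]).leadingCoeff = 0 := by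
      rw [leadingCoeff, heq, coeff_eliminantAt]
      exact h0
    exact h.eliminantAt_ne_zero _ (leadingCoeff_eq_zero.1 this)
  have h2 : (aeval coordX (eliminantAt P Q M N ![u, v'])).orderTop <
      (aeval coordX (eliminantAt P Q M N ![u, v])).orderTop := by
    refine (orderTop_aeval_coordX_le (n := n) (by rw [coeff_eliminantAt]; exact h1)).trans_lt
      (lt_of_lt_of_le (WithTop.coe_lt_coe.2 ?_) (neg_natDegree_le_orderTop_aeval_coordX _))
    have : ((eliminantAt P Q M N ![u, v]).natDegree : ℚ) < n := by exact_mod_cast hlt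
    linarith
  refine absurd h2 (not_lt.2 ?_)
  rw [h.aeval_eliminantAt_eq_prod, h.aeval_eliminantAt_eq_prod, orderTop_mul, orderTop_mul]
  refine add_le_add le_rfl (orderTop_prod_le _ fun y hy => ?_)
  have hy' := hno y ((h.mem_roots_slice _ _ _).1 hy)
  simp only [Matrix.cons_val_one, Matrix.cons_val_zero]
  have h3 : (0 : WithTop ℚ) ≤
      (algebraMap ℂ (HahnSeries ℚ ℂ) v - algebraMap ℂ (HahnSeries ℚ ℂ) v').orderTop := by
    rw [← map_sub, algebraMap_eq_single]
    exact orderTop_single_le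
  have h4 := le_orderTop_add (le_refl
    (MvPolynomial.aeval ![coordX, y] Q - algebraMap ℂ (HahnSeries ℚ ℂ) v).orderTop) (hy'.trans h3)
  rwa [sub_add_sub_cancel] at h4

/-! ### The non-proper value set is the zero set of the leading coefficient of the eliminant -/

/-- Outside the unit disc the top term must be balanced by `n` terms of norm at most `c ‖z‖ ^ (n -
1)`. -/
theorem norm_le_of_eval_eq_zero {r : ℂ[X]} {n : ℕ} (hr : r.natDegree ≤ n) {η c : ℝ} (hη : 0 < η)
    (hn : η ≤ ‖r.coeff n‖) (hc : ∀ i ∈ Finset.range n, ‖r.coeff i‖ ≤ c) {z : ℂ}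
    (hz : r.eval z = 0) : ‖z‖ ≤ n * c / η + 1 := by
  rcases Nat.eq_zero_or_pos n with rfl | hpos
  · rw [eq_C_of_natDegree_le_zero hr, eval_C] at hz
    rw [hz, norm_zero] at hn
    linarith
  have hc0 : 0 ≤ c := (norm_nonneg _).trans (hc 0 (Finset.mem_range.2 hpos))
  rcases le_or_gt ‖z‖ 1 with h1 | h1
  · have : 0 ≤ n * c / η := by positivity
    linarith
  rw [eval_eq_sum_range' (Nat.lt_succ_of_le hr), Finset.sum_range_succ, add_eq_zero_iff_eq_neg'] at hz
  have h2 : ‖r.coeff n * z ^ n‖ ≤ n * c * ‖z‖ ^ (n - 1) := by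
    rw [hz, norm_neg]
    refine (norm_sum_le _ _).trans ?_
    have : ∀ i ∈ Finset.range n, ‖r.coeff i * z ^ i‖ ≤ c * ‖z‖ ^ (n - 1) := by
      intro i hi
      rw [norm_mul, norm_pow]
      refine mul_le_mul (hc i hi) (pow_le_pow_right₀ h1.le ?_) (by positivity) hc0
      have := Finset.mem_range.1 hi
      omega
    refine (Finset.sum_le_sum this).trans ?_
    rw [Finset.sum_const, Finset.card_range, nsmul_eq_mul, mul_assoc]
  rw [norm_mul, norm_pow, ← Nat.sub_add_cancel hpos, pow_succ, Nat.sub_add_cancel hpos] at h2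
  have h3 : 0 < ‖z‖ ^ (n - 1) := by positivity
  have h4 : η * ‖z‖ ≤ n * c := by
    have h5 : ‖r.coeff n‖ * ‖z‖ ≤ n * c := by
      refine le_of_mul_le_mul_right ?_ h3
      linarith
    exact (mul_le_mul_of_nonneg_right hn (norm_nonneg z)).trans h5
  have : ‖z‖ ≤ n * c / η := by
    rw [le_div_iff₀ hη]
    linarith
  linarith

theorem IsCompact.exists_norm_root_le {Y : Type*} [TopologicalSpace Y] {s : Set Y}
    (hs : IsCompact s) {r : Y → ℂ[X]} {n : ℕ} (hdeg : ∀ y, (r y).natDegree ≤ n)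
    (hcont : ∀ i, Continuous fun y => (r y).coeff i) (hn : ∀ y ∈ s, (r y).coeff n ≠ 0) :
    ∃ c : ℝ, ∀ y ∈ s, ∀ z : ℂ, (r y).eval z = 0 → ‖z‖ ≤ c := by
  rcases s.eq_empty_or_nonempty with rfl | hne
  · exact ⟨0, by simp⟩
  obtain ⟨y₀, hy₀, hmin⟩ := hs.exists_isMinOn hne (hcont n).norm.continuousOn
  choose c hc using fun i => hs.exists_bound_of_continuousOn (hcont i).continuousOn
  refine ⟨n * (∑ i ∈ Finset.range n, |c i|) / ‖(r y₀).coeff n‖ + 1, fun y hy z hz => ?_⟩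
  refine norm_le_of_eval_eq_zero (hdeg y) (norm_pos_iff.2 (hn y₀ hy₀)) (hmin hy) (fun i hi => ?_) hz
  exact ((hc i y hy).trans (le_abs_self _)).trans
    (Finset.single_le_sum (f := fun i => |c i|) (fun _ _ => abs_nonneg _) hi)

theorem MvPolynomial.exists_eval_ne_zero_of_mem_nhds {r : MvPolynomial (Fin 2) ℂ} (hr : r ≠ 0)
    {a : Fin 2 → ℂ} {U : Set (Fin 2 → ℂ)} (hU : U ∈ 𝓝 a) : ∃ b ∈ U, MvPolynomial.eval b r ≠ 0 := by
  by_contra! hno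
  rw [nhds_pi, Filter.mem_pi] at hU
  obtain ⟨I, -, t, ht, htU⟩ := hU
  refine hr (MvPolynomial.funext_set t (fun i => infinite_of_mem_nhds (a i) (ht i)) fun x hx => ?_)
  rw [map_zero]
  exact hno x (htU fun i _ => hx i (Set.mem_univ i))

theorem continuous_polyMap (P Q : MvPolynomial (Fin 2) ℂ) : Continuous (polyMap P Q) := by
  refine continuous_pi fun i => ?_
  fin_cases i
  · exact MvPolynomial.continuous_eval P
  · exact MvPolynomial.continuous_eval Q

theorem continuous_coeff_verticalSlice (P : MvPolynomial (Fin 2) ℂ) (i : ℕ) :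
    Continuous fun x : ℂ => (verticalSlice P x).coeff i := by
  simp only [coeff_verticalSlice]
  refine continuous_finsetSum _ fun m _ => ?_
  split_ifs
  · fun_prop
  · exact continuous_const

namespace IsKellerPair

variable {P Q : MvPolynomial (Fin 2) ℂ} {M N : ℕ} {A B j : ℂ}

theorem continuous_coeff_eliminantAt (i : ℕ) :
    Continuous fun a => (eliminantAt P Q M N a).coeff i := by
  simp only [coeff_eliminantAt]
  exact MvPolynomial.continuous_eval _

/-- The eliminant bounds `x`; then `P(x, y) = u`, whose leading coefficient in `y` is the constant
`A`, bounds `y`. -/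
theorem isCompact_preimage (h : IsKellerPair P Q M N A B j) {s : Set (Fin 2 → ℂ)}
    (hs : IsCompact s)
    (hlc : ∀ a ∈ s, MvPolynomial.eval a (eliminant P Q M N).leadingCoeff ≠ 0) :
    IsCompact (polyMap P Q ⁻¹' s) := by
  obtain ⟨c, hc⟩ := hs.exists_norm_root_le (r := eliminantAt P Q M N)
    (natDegree_eliminantAt_le P Q M N) continuous_coeff_eliminantAt
    (fun a ha => by rw [coeff_eliminantAt]; exact hlc a ha)
  have hs' : IsCompact (Metric.closedBall (0 : ℂ) c ×ˢ s) := (isCompact_closedBall 0 c).prod hs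
  obtain ⟨c', hc'⟩ := hs'.exists_norm_root_le
    (r := fun y : ℂ × (Fin 2 → ℂ) => verticalSlice P y.1 - C (y.2 0)) (n := M)
    (fun y => (h.natDegree_slice y.1 (y.2 0)).1.le)
    (fun i => by
      simp only [coeff_sub, coeff_C]
      refine ((continuous_coeff_verticalSlice P i).comp continuous_fst).sub ?_
      split_ifs
      · fun_prop
      · exact continuous_const)
    (fun y _ => by
      have h1 := h.natDegree_slice y.1 (y.2 0)
      have h2 := h1.2
      rw [leadingCoeff, h1.1] at h2
      rw [h2]
      simpa using h.A_ne)
  refine Metric.isCompact_of_isClosed_isBounded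
    (hs.isClosed.preimage (continuous_polyMap P Q)) ?_
  rw [isBounded_iff_forall_norm_le]
  refine ⟨max (max c c') 0, fun z hz => (pi_norm_le_iff_of_nonneg (le_max_right _ _)).2 ?_⟩
  have h0 : ‖z 0‖ ≤ c := hc _ hz _ (h.eval_polyMap_eliminantAt z)
  have h1 : ‖z 1‖ ≤ c' := by
    refine hc' (z 0, polyMap P Q z) ⟨by simpa using h0, hz⟩ (z 1) ?_
    have hzz : ![z 0, z 1] = z := by ext i; fin_cases i <;> rfl
    rw [eval_sub, eval_C, eval_verticalSlice, hzz]
    simp [polyMap, MvPolynomial.aeval_eq_eval]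
  intro i
  fin_cases i
  · exact h0.trans ((le_max_left _ _).trans (le_max_left _ _))
  · exact h1.trans ((le_max_right _ _).trans (le_max_left _ _))

/-- Every root of the eliminant over `a` is the first coordinate of a point of the fibre, so each
linear factor has norm at most `‖x‖ + c`. -/
theorem norm_eval_eliminantAt_le (h : IsKellerPair P Q M N A B j) {a : Fin 2 → ℂ} {c : ℝ}
    (hlc : MvPolynomial.eval a (eliminant P Q M N).leadingCoeff ≠ 0)
    (hc : ∀ z, polyMap P Q z = a → ‖z 0‖ ≤ c) (x : ℂ) :
    ‖(eliminantAt P Q M N a).eval x‖ ≤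
      ‖MvPolynomial.eval a (eliminant P Q M N).leadingCoeff‖ *
        (‖x‖ + c) ^ (eliminant P Q M N).natDegree := by
  set r := eliminantAt P Q M N a with hr
  have hcoeff : r.coeff (eliminant P Q M N).natDegree =
      MvPolynomial.eval a (eliminant P Q M N).leadingCoeff := coeff_eliminantAt ..
  have hdeg : r.natDegree = (eliminant P Q M N).natDegree :=
    natDegree_eq_of_le_of_coeff_ne_zero (natDegree_eliminantAt_le ..) (by rwa [hcoeff])
  have hlead : r.leadingCoeff = MvPolynomial.eval a (eliminant P Q M N).leadingCoeff := by
    rw [leadingCoeff, hdeg, hcoeff]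
  have hs := IsAlgClosed.splits r
  have hr0 : r ≠ 0 := h.eliminantAt_ne_zero a
  rw [hs.eval_eq_prod_roots, norm_mul, hlead, ← hdeg, hs.natDegree_eq_card_roots]
  refine mul_le_mul_of_nonneg_left ?_ (norm_nonneg _)
  have key : ∀ m : Multiset ℂ, (∀ y ∈ m, ‖y‖ ≤ c) →
      ‖(m.map fun y => x - y).prod‖ ≤ (‖x‖ + c) ^ Multiset.card m := by
    intro m
    induction m using Multiset.induction_on with
    | empty => simp
    | cons y m ih =>
      intro hm
      have hy : ‖x - y‖ ≤ ‖x‖ + c :=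
        (norm_sub_le _ _).trans (add_le_add le_rfl (hm y (Multiset.mem_cons_self y m)))
      rw [Multiset.map_cons, Multiset.prod_cons, norm_mul, Multiset.card_cons, pow_succ']
      exact mul_le_mul hy (ih fun z hz => hm z (Multiset.mem_cons_of_mem hz)) (norm_nonneg _)
        ((norm_nonneg _).trans hy)
  refine key _ fun y hy => ?_
  obtain ⟨z, hz, hza⟩ := h.exists_polyMap_eq ((mem_roots hr0).1 hy)
  rw [← hz]
  exact hc z hza

/-- If the leading coefficient vanishes at `a` but a neighbourhood has compact preimage, the roots
`x` stay bounded over it. Approaching `a` through points where the coefficient is nonzero, the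
eliminant then tends to zero at every `x`, although it is not the zero polynomial over `a`. -/
theorem nonProperValueSet_eq (h : IsKellerPair P Q M N A B j) :
    nonProperValueSet (polyMap P Q) =
      {a | MvPolynomial.eval a (eliminant P Q M N).leadingCoeff = 0} := by
  set L := (eliminant P Q M N).leadingCoeff with hL
  have hL0 : L ≠ 0 := leadingCoeff_ne_zero.2 h.eliminant_ne_zero
  ext a
  rw [Set.mem_ofPred_eq]
  constructor
  · intro ha
    by_contra hne
    have hopen : {b | MvPolynomial.eval b L ≠ 0} ∈ 𝓝 a :=
      (isOpen_ne_fun (MvPolynomial.continuous_eval L) continuous_const).mem_nhds hne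
    obtain ⟨ε, hε, hball⟩ := Metric.nhds_basis_closedBall.mem_iff.1 hopen
    exact ha _ (Metric.closedBall_mem_nhds a hε) (isCompact_closedBall a ε)
      (h.isCompact_preimage (isCompact_closedBall a ε) hball)
  · intro ha U hU _ hcomp
    obtain ⟨c, hc⟩ := isBounded_iff_forall_norm_le.1 hcomp.isBounded
    obtain ⟨x, hx⟩ : ∃ x, (eliminantAt P Q M N a).eval x ≠ 0 := by
      by_contra! hall
      exact h.eliminantAt_ne_zero a (Polynomial.funext (by simpa using hall))
    have hNB : (𝓝[{b | MvPolynomial.eval b L ≠ 0}] a).NeBot := by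
      rw [← mem_closure_iff_nhdsWithin_neBot, mem_closure_iff_nhds]
      intro V hV
      obtain ⟨b, hb, hb'⟩ := MvPolynomial.exists_eval_ne_zero_of_mem_nhds hL0 hV
      exact ⟨b, hb, hb'⟩
    have h1 : Tendsto (fun b => ‖(eliminantAt P Q M N b).eval x‖)
        (𝓝[{b | MvPolynomial.eval b L ≠ 0}] a) (𝓝 ‖(eliminantAt P Q M N a).eval x‖) := by
      refine (Continuous.tendsto ?_ a).mono_left nhdsWithin_le_nhds
      refine Continuous.norm ?_
      have : ∀ b, (eliminantAt P Q M N b).eval x =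
          ∑ i ∈ Finset.range ((eliminant P Q M N).natDegree + 1),
            (eliminantAt P Q M N b).coeff i * x ^ i := fun b =>
        eval_eq_sum_range' (Nat.lt_succ_of_le (natDegree_eliminantAt_le P Q M N b)) x
      simp only [this]
      exact continuous_finsetSum _ fun i _ =>
        (continuous_coeff_eliminantAt i).mul continuous_const
    have h2 : Tendsto (fun b => ‖MvPolynomial.eval b L‖ *
        (‖x‖ + c) ^ (eliminant P Q M N).natDegree)
        (𝓝[{b | MvPolynomial.eval b L ≠ 0}] a) (𝓝 0) := by
      have h3 : Tendsto (fun b => ‖MvPolynomial.eval b L‖ *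
          (‖x‖ + c) ^ (eliminant P Q M N).natDegree) (𝓝 a)
          (𝓝 (‖MvPolynomial.eval a L‖ * (‖x‖ + c) ^ (eliminant P Q M N).natDegree)) :=
        (((MvPolynomial.continuous_eval L).norm.mul continuous_const).tendsto a)
      rw [ha, norm_zero, zero_mul] at h3
      exact h3.mono_left nhdsWithin_le_nhds
    have h3 : ‖(eliminantAt P Q M N a).eval x‖ ≤ 0 := by
      refine le_of_tendsto_of_tendsto h1 h2 ?_
      filter_upwards [self_mem_nhdsWithin, mem_nhdsWithin_of_mem_nhds hU] with b hb hbU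
      refine h.norm_eval_eliminantAt_le hb (fun z hz => ?_) x
      exact (norm_le_pi_norm z 0).trans (hc z (by rw [Set.mem_preimage, hz]; exact hbU))
    exact hx (norm_le_zero_iff.1 h3)

end IsKellerPair

open HahnSeries (coordX SimilarAtInfinity algebraMap_eq_single)

/-! ### Asymptotics of the non-proper value set -/

theorem swap_mem_nonProperValueSet {P Q : MvPolynomial (Fin 2) ℂ} {u v : ℂ}
    (h : ![u, v] ∈ nonProperValueSet (polyMap P Q)) :
    ![v, u] ∈ nonProperValueSet (polyMap Q P) := by
  intro U hU hUc hpre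
  let σ : (Fin 2 → ℂ) → Fin 2 → ℂ := fun z => ![z 1, z 0]
  have hσ : Continuous σ := by
    refine continuous_pi fun i => ?_
    fin_cases i
    · exact continuous_apply 1
    · exact continuous_apply 0
  have hσσ : ∀ z, σ (σ z) = z := by
    intro z
    ext i
    fin_cases i <;> rfl
  have himg : σ ⁻¹' U = σ '' U := by
    ext z
    exact ⟨fun hz => ⟨σ z, hz, hσσ z⟩, by rintro ⟨w, hw, rfl⟩; rwa [Set.mem_preimage, hσσ]⟩
  refine h (σ ⁻¹' U) (hσ.continuousAt.preimage_mem_nhds hU) (himg ▸ hUc.image hσ) ?_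
  exact hpre

theorem MvPolynomial.eval_aeval_polynomial (g : Fin 2 → ℂ[X]) (L : MvPolynomial (Fin 2) ℂ) (t : ℂ) :
    (MvPolynomial.aeval g L).eval t = MvPolynomial.eval (fun i => (g i).eval t) L := by
  rw [← coe_evalRingHom, ← MvPolynomial.coe_aeval_eq_eval]
  rw [RingHom.coe_coe, MvPolynomial.aeval_def, MvPolynomial.hom_eval₂, MvPolynomial.aeval_def]
  congr 1
  ext
  simp

namespace IsKellerPair

variable {P Q : MvPolynomial (Fin 2) ℂ} {A B j : ℂ} {M N : ℕ}

theorem exists_finite_curves_of_eval_ne_zero {d e : ℕ} (h : IsKellerPair P Q M N A B j)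
    (hd : d ≠ 0) (he : e ≠ 0) (hMN : e * M = d * N) :
    ∃ S : Set (ℂ[X] × ℂ[X]), S.Finite ∧ (∀ c ∈ S, SimilarAtInfinity d e A B c.1 c.2) ∧
      ∀ u v v', ![u, v] ∈ nonProperValueSet (polyMap P Q) →
        ![u, v'] ∉ nonProperValueSet (polyMap P Q) →
        ∃ c ∈ S, ∃ ξ : ℂ, c.1.eval ξ = u ∧ c.2.eval ξ = v := by
  obtain ⟨S, hS, hS', hS''⟩ := HahnSeries.exists_finite_curves h.jacobian hd he h.M_ne hMN
    h.degree_fst h.degree_snd h.coeff_fst h.A_ne h.coeff_snd h.B_ne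
  refine ⟨S, hS, hS', fun u v v' h0 h1 => ?_⟩
  rw [h.nonProperValueSet_eq] at h0 h1
  obtain ⟨φ, hP, hQ⟩ := h.exists_arc h0 h1
  have h2 : ∀ c : ℂ, 0 ≤ (algebraMap ℂ (HahnSeries ℚ ℂ) c).orderTop := by
    intro c
    rw [algebraMap_eq_single]
    exact HahnSeries.orderTop_single_le
  have h3 := HahnSeries.le_orderTop_add hQ.le (h2 v)
  rw [sub_add_cancel] at h3
  obtain ⟨c, hc, ξ, hξ, hξ'⟩ := hS'' φ (by rw [hP]; exact h2 u) h3
  refine ⟨c, hc, ξ, ?_, ?_⟩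
  · rw [hξ, hP, algebraMap_eq_single, HahnSeries.coeff_single_same]
    rfl
  · have h4 := HahnSeries.coeff_eq_zero_of_lt_orderTop (i := 0) hQ
    rw [HahnSeries.coeff_sub, algebraMap_eq_single, HahnSeries.coeff_single_same, sub_eq_zero] at h4
    rw [hξ', h4]
    rfl

/-- An arc with `P` constant or one with `Q` constant reaches the point, unless the vertical and the
horizontal line through it both lie in the non-proper value set. A nonzero polynomial vanishes on
finitely many such lines, so these points are finite in number. -/
theorem exists_finite_cover {d e : ℕ} (h : IsKellerPair P Q M N A B j)
    (hd : d ≠ 0) (he : e ≠ 0) (hMN : e * M = d * N) :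
    ∃ (S : Set (ℂ[X] × ℂ[X])) (E : Set (Fin 2 → ℂ)), S.Finite ∧ E.Finite ∧
      (∀ c ∈ S, SimilarAtInfinity d e A B c.1 c.2) ∧
      ∀ a ∈ nonProperValueSet (polyMap P Q), a ∈ E ∨
        ∃ c ∈ S, ∃ ξ : ℂ, ![c.1.eval ξ, c.2.eval ξ] = a := by
  obtain ⟨S, hS, hSs, hSc⟩ := h.exists_finite_curves_of_eval_ne_zero hd he hMN
  obtain ⟨S', hS', hSs', hSc'⟩ := h.symm.exists_finite_curves_of_eval_ne_zero he hd hMN.symm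
  have key : ∀ L : MvPolynomial (Fin 2) ℂ, L ≠ 0 →
      {u | ∀ v, MvPolynomial.eval ![u, v] L = 0}.Finite ∧
      {v | ∀ u, MvPolynomial.eval ![u, v] L = 0}.Finite := by
    intro L hL
    obtain ⟨b, hb⟩ : ∃ b, MvPolynomial.eval b L ≠ 0 := by
      by_contra! hno
      exact hL (MvPolynomial.funext (by simpa using hno))
    have hb' : ![b 0, b 1] = b := by ext i; fin_cases i <;> rfl
    have hpoly : ∀ g : Fin 2 → ℂ[X], (∃ t, ∀ i, (g i).eval t = b i) →
        {t | MvPolynomial.eval (fun i => (g i).eval t) L = 0}.Finite := by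
      rintro g ⟨t₀, ht₀⟩
      have h0 : MvPolynomial.aeval g L ≠ 0 := by
        intro h0
        have := MvPolynomial.eval_aeval_polynomial g L t₀
        simp only [h0, eval_zero, ht₀] at this
        exact hb this.symm
      refine (finite_setOfPred_isRoot h0).subset fun t ht => ?_
      rw [Set.mem_ofPred_eq, IsRoot, MvPolynomial.eval_aeval_polynomial]
      exact ht
    constructor
    · refine (hpoly ![X, C (b 1)] ⟨b 0, fun i => by fin_cases i <;> simp⟩).subset fun u hu => ?_
      rw [Set.mem_ofPred_eq, ← hu (b 1)]
      congr 2
      ext i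
      fin_cases i <;> simp
    · refine (hpoly ![C (b 0), X] ⟨b 1, fun i => by fin_cases i <;> simp⟩).subset fun v hv => ?_
      rw [Set.mem_ofPred_eq, ← hv (b 0)]
      congr 2
      ext i
      fin_cases i <;> simp
  obtain ⟨hf1, hf2⟩ := key (eliminant P Q M N).leadingCoeff
    (leadingCoeff_ne_zero.2 h.eliminant_ne_zero)
  refine ⟨S ∪ (fun c => (c.2, c.1)) '' S',
    (fun c : ℂ × ℂ => ![c.1, c.2]) '' ({u | ∀ v, MvPolynomial.eval ![u, v]
      (eliminant P Q M N).leadingCoeff = 0} ×ˢ {v | ∀ u, MvPolynomial.eval ![u, v]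
      (eliminant P Q M N).leadingCoeff = 0}), hS.union (hS'.image _), (hf1.prod hf2).image _,
    ?_, ?_⟩
  · rintro c (hc | ⟨c', hc', rfl⟩)
    · exact hSs c hc
    · exact (hSs' c' hc').symm hd
  · intro a ha
    have ha' : ![a 0, a 1] = a := by ext i; fin_cases i <;> rfl
    have hset := h.nonProperValueSet_eq
    rw [← ha'] at ha
    by_cases h1 : ∃ v, ![a 0, v] ∉ nonProperValueSet (polyMap P Q)
    · obtain ⟨v, hv⟩ := h1
      obtain ⟨c, hc, ξ, hξ, hξ'⟩ := hSc _ _ _ ha hv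
      exact Or.inr ⟨c, Or.inl hc, ξ, by rw [hξ, hξ', ha']⟩
    by_cases h2 : ∃ u, ![u, a 1] ∉ nonProperValueSet (polyMap P Q)
    · obtain ⟨u, hu⟩ := h2
      obtain ⟨c, hc, ξ, hξ, hξ'⟩ := hSc' _ _ _ (swap_mem_nonProperValueSet ha)
        (fun h' => hu (swap_mem_nonProperValueSet h'))
      exact Or.inr ⟨(c.2, c.1), Or.inr ⟨c, hc, rfl⟩, ξ, by rw [hξ, hξ', ha']⟩
    · push Not at h1 h2
      rw [hset] at h1 h2
      exact Or.inl ⟨(a 0, a 1), ⟨h1, h2⟩, ha'⟩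

end IsKellerPair

theorem Polynomial.tendsto_eval_div_pow_cobounded (f : ℂ[X]) :
    Tendsto (fun ξ => f.eval ξ / ξ ^ f.natDegree) (Bornology.cobounded ℂ) (𝓝 f.leadingCoeff) := by
  have h1 : Tendsto (fun ξ : ℂ => f.reverse.eval ξ⁻¹) (Bornology.cobounded ℂ)
      (𝓝 (f.reverse.eval 0)) :=
    (f.reverse.continuous.tendsto 0).comp tendsto_inv₀_cobounded
  rw [← coeff_zero_eq_eval_zero, coeff_zero_reverse] at h1
  refine h1.congr' ?_
  filter_upwards [Bornology.eventually_ne_cobounded (0 : ℂ)] with ξ hξ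
  let := invertibleOfNonzero hξ
  have h2 := eval₂_reverse_mul_pow (RingHom.id ℂ) ξ f
  rw [eval₂_id, eval₂_id, invOf_eq_inv] at h2
  rw [← h2, mul_div_cancel_right₀ _ (pow_ne_zero _ hξ)]

theorem HahnSeries.SimilarAtInfinity.tendsto {d e : ℕ} {A B : ℂ} {p q : ℂ[X]} (hB : B ≠ 0)
    (h : SimilarAtInfinity d e A B p q) :
    Tendsto (fun ξ => p.eval ξ ^ e / q.eval ξ ^ d) (cocompact ℂ) (𝓝 (A ^ e / B ^ d)) := by
  rw [← Metric.cobounded_eq_cocompact]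
  have hp0 : p.leadingCoeff ≠ 0 := by
    rw [Polynomial.leadingCoeff_ne_zero]
    rintro rfl
    exact h.natDegree_ne_zero natDegree_zero
  have hq0 : q.leadingCoeff ^ d ≠ 0 := by
    intro h0
    have := h.leadingCoeff_pow
    rw [h0, mul_zero] at this
    exact mul_ne_zero (pow_ne_zero _ hp0) (pow_ne_zero _ hB) this
  have hlim : A ^ e / B ^ d = p.leadingCoeff ^ e / q.leadingCoeff ^ d := by
    rw [div_eq_div_iff (pow_ne_zero _ hB) hq0, h.leadingCoeff_pow]
  rw [hlim]
  refine (((p.tendsto_eval_div_pow_cobounded).pow e).div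
    ((q.tendsto_eval_div_pow_cobounded).pow d) hq0).congr' ?_
  filter_upwards [Bornology.eventually_ne_cobounded (0 : ℂ)] with ξ hξ
  rw [Pi.div_apply, div_pow, div_pow, ← pow_mul, ← pow_mul, mul_comm p.natDegree, mul_comm q.natDegree,
    h.natDegree_mul, div_div_div_cancel_right₀ (pow_ne_zero _ hξ)]

/-- On each of the finitely many curves the ratio converges as the parameter goes to infinity;
bounded parameters and the exceptional points only contribute a compact set. -/
theorem IsKellerPair.tendsto_ratio {P Q : MvPolynomial (Fin 2) ℂ} {A B j : ℂ} {M N d e : ℕ}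
    (h : IsKellerPair P Q M N A B j) (hd : d ≠ 0) (he : e ≠ 0) (hMN : e * M = d * N) :
    Tendsto (fun a : Fin 2 → ℂ => a 0 ^ e / a 1 ^ d)
      (cocompact (Fin 2 → ℂ) ⊓ 𝓟 (nonProperValueSet (polyMap P Q))) (𝓝 (A ^ e / B ^ d)) := by
  obtain ⟨S, E, hS, hE, hSs, hcov⟩ := h.exists_finite_cover hd he hMN
  intro W hW
  rw [Filter.mem_map, mem_inf_principal, mem_cocompact]
  have hcpt : ∀ c : ℂ[X] × ℂ[X], c ∈ S → ∃ T : Set ℂ, IsCompact T ∧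
      Tᶜ ⊆ {ξ | c.1.eval ξ ^ e / c.2.eval ξ ^ d ∈ W} := fun c hc =>
    mem_cocompact.1 ((hSs c hc).tendsto h.B_ne hW)
  choose! T hT hTW using hcpt
  refine ⟨E ∪ ⋃ c ∈ S, (fun ξ => ![c.1.eval ξ, c.2.eval ξ]) '' T c,
    hE.isCompact.union (hS.isCompact_biUnion fun c hc => (hT c hc).image ?_), ?_⟩
  · refine continuous_pi fun i => ?_
    fin_cases i
    · exact c.1.continuous
    · exact c.2.continuous
  · intro a ha haS
    simp only [Set.mem_compl_iff, Set.mem_union, Set.mem_iUnion, not_or, not_exists] at ha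
    obtain haE | ⟨c, hc, ξ, rfl⟩ := hcov a haS
    · exact absurd haE ha.1
    · exact hTW c hc fun hξ => ha.2 c hc ⟨ξ, hξ, rfl⟩

/-! ### Points at infinity -/

/-- If all zeros had norm at most `c`, then `R` would have no zero on a horizontal or vertical line
beyond `c`, hence be constant on each of them. Such lines cross, so `R` would be constant. -/
theorem not_isBounded_zeroSet {R : MvPolynomial (Fin 2) ℂ} (hR : R.totalDegree ≠ 0) :
    ¬ Bornology.IsBounded {a : Fin 2 → ℂ | MvPolynomial.eval a R = 0} := by
  intro hb
  obtain ⟨c, hc⟩ := isBounded_iff_forall_norm_le.1 hb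
  have key : ∀ g : Fin 2 → ℂ[X], (∃ i, ∃ z : ℂ, c < ‖z‖ ∧ g i = C z) → ∀ t t',
      MvPolynomial.eval (fun i => (g i).eval t) R =
        MvPolynomial.eval (fun i => (g i).eval t') R := by
    rintro g ⟨i, z, hz, hg⟩ t t'
    have hnr : (MvPolynomial.aeval g R).degree = 0 ∨ MvPolynomial.aeval g R = 0 := by
      by_contra! hno
      obtain ⟨w, hw⟩ := IsAlgClosed.exists_root _ hno.1
      rw [IsRoot, MvPolynomial.eval_aeval_polynomial] at hw
      have h1 := (norm_le_pi_norm _ i).trans (hc _ hw)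
      simp only [hg, eval_C] at h1
      linarith
    rw [← MvPolynomial.eval_aeval_polynomial, ← MvPolynomial.eval_aeval_polynomial]
    rcases hnr with h | h
    · rw [eq_C_of_degree_eq_zero h, eval_C, eval_C]
    · rw [h, eval_zero, eval_zero]
  have hv : ∀ u v v' : ℂ, c < ‖u‖ → MvPolynomial.eval ![u, v] R = MvPolynomial.eval ![u, v'] R := by
    intro u v v' hu
    have hg : ∀ t, (fun i => (![C u, X] i : ℂ[X]).eval t) = ![u, t] := fun t => by
      funext i
      fin_cases i <;> simp
    simpa only [hg] using key ![C u, X] ⟨0, u, hu, rfl⟩ v v'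
  have hu : ∀ u u' v : ℂ, c < ‖v‖ → MvPolynomial.eval ![u, v] R = MvPolynomial.eval ![u', v] R := by
    intro u u' v hv
    have hg : ∀ t, (fun i => (![X, C v] i : ℂ[X]).eval t) = ![t, v] := fun t => by
      funext i
      fin_cases i <;> simp
    simpa only [hg] using key ![X, C v] ⟨1, v, hv, rfl⟩ u u'
  have hinf : {z : ℂ | c < ‖z‖}.Infinite := by
    intro hfin
    have h1 : ∀ᶠ z : ℂ in Bornology.cobounded ℂ, c < ‖z‖ :=
      tendsto_norm_cobounded_atTop.eventually_gt_atTop c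
    have h2 : ∀ᶠ z : ℂ in Bornology.cobounded ℂ, ¬ c < ‖z‖ := by
      have := hfin.isBounded
      rwa [← Bornology.isCobounded_compl_iff] at this
    obtain ⟨z, hz, hz'⟩ := (h1.and h2).exists
    exact hz' hz
  obtain ⟨z₀, hz₀⟩ := hinf.nonempty
  have hconst : R = MvPolynomial.C (MvPolynomial.eval ![z₀, z₀] R) := by
    refine MvPolynomial.funext_set (fun _ => {z : ℂ | c < ‖z‖}) (fun _ => hinf) fun x hx => ?_
    have hx' : ![x 0, x 1] = x := by ext i; fin_cases i <;> rfl
    rw [MvPolynomial.eval_C, ← hx', hv _ _ z₀ (hx 0 (Set.mem_univ _)), hu _ z₀ _ hz₀]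
  rw [hconst, MvPolynomial.totalDegree_C] at hR
  exact hR rfl

theorem continuous_projectivization_mk :
    Continuous (Projectivization.mk' ℂ : {w : Fin 3 → ℂ // w ≠ 0} → ComplexProjectivePlane) :=
  continuous_quot_mk

theorem isOpenMap_projectivization_mk :
    IsOpenMap (Projectivization.mk' ℂ : {w : Fin 3 → ℂ // w ≠ 0} → ComplexProjectivePlane) := by
  intro U hU
  have hq : IsQuotientMap
      (Projectivization.mk' ℂ : {w : Fin 3 → ℂ // w ≠ 0} → ComplexProjectivePlane) :=
    isQuotientMap_quot_mk
  rw [← hq.isOpen_preimage]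
  have hset : Projectivization.mk' ℂ ⁻¹' (Projectivization.mk' ℂ '' U) =
      ⋃ t : ℂˣ, (fun w : {w : Fin 3 → ℂ // w ≠ 0} =>
        (⟨(t : ℂ) • w.1, smul_ne_zero t.ne_zero w.2⟩ : {w : Fin 3 → ℂ // w ≠ 0})) ⁻¹' U := by
    ext w
    simp only [Set.mem_preimage, Set.mem_image, Set.mem_iUnion, Projectivization.mk'_eq_mk]
    constructor
    · rintro ⟨w', hw', heq⟩
      obtain ⟨t, ht⟩ := (Projectivization.mk_eq_mk_iff ℂ _ _ w'.2 w.2).1 heq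
      refine ⟨t, ?_⟩
      convert hw' using 1
      exact Subtype.ext ht
    · rintro ⟨t, ht⟩
      exact ⟨_, ht, (Projectivization.mk_eq_mk_iff ℂ _ _ _ w.2).2 ⟨t, rfl⟩⟩
  rw [hset]
  refine isOpen_iUnion fun t => hU.preimage ?_
  exact (continuous_subtype_val.const_smul (t : ℂ)).subtype_mk _

theorem mk_eq_affineChart_iff {w : Fin 3 → ℂ} (hw : w ≠ 0) {a : Fin 2 → ℂ} :
    Projectivization.mk ℂ w hw = affineChart a ↔
      w 0 ≠ 0 ∧ w 1 = w 0 * a 0 ∧ w 2 = w 0 * a 1 := by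
  rw [affineChart, Projectivization.mk_eq_mk_iff']
  constructor
  · rintro ⟨t, rfl⟩
    refine ⟨fun h => hw ?_, by simp, by simp⟩
    have : t = 0 := by simpa using h
    rw [this, zero_smul]
  · rintro ⟨-, h1, h2⟩
    refine ⟨w 0, ?_⟩
    ext i
    fin_cases i
    · simp
    · simp [h1]
    · simp [h2]

theorem mk_mem_range_affineChart_iff {w : Fin 3 → ℂ} (hw : w ≠ 0) :
    Projectivization.mk ℂ w hw ∈ Set.range affineChart ↔ w 0 ≠ 0 := by
  constructor
  · rintro ⟨a, ha⟩
    exact ((mk_eq_affineChart_iff hw).1 ha.symm).1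
  · intro h
    refine ⟨![w 1 / w 0, w 2 / w 0], ((mk_eq_affineChart_iff hw).2 ⟨h, ?_, ?_⟩).symm⟩
    · simp [mul_div_cancel₀ _ h]
    · simp [mul_div_cancel₀ _ h]

/-- Scale `(1, u, v)` to the unit sphere and take the limit along an ultrafilter going to infinity
in `S`; the first coordinate tends to zero. -/
theorem pointsAtInfinity_nonempty {S : Set (Fin 2 → ℂ)} (hS : ¬ Bornology.IsBounded S) :
    (pointsAtInfinity S).Nonempty := by
  have hNB : (cocompact (Fin 2 → ℂ) ⊓ 𝓟 S).NeBot := by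
    rw [inf_principal_neBot_iff]
    intro U hU
    by_contra hemp
    rw [← Metric.cobounded_eq_cocompact] at hU
    refine hS ((Bornology.isBounded_compl_iff.2 hU).subset fun a ha haU => hemp ⟨a, haU, ha⟩)
  obtain ⟨𝒰, h𝒰⟩ := Ultrafilter.exists_le (cocompact (Fin 2 → ℂ) ⊓ 𝓟 S)
  let W : (Fin 2 → ℂ) → Fin 3 → ℂ := fun a => ![1, a 0, a 1]
  have hW1 : ∀ a, 1 ≤ ‖W a‖ := fun a => by
    have := norm_le_pi_norm (W a) 0
    simpa [W] using this
  have hW2 : ∀ a, ‖a‖ ≤ ‖W a‖ := fun a => by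
    refine (pi_norm_le_iff_of_nonneg (norm_nonneg _)).2 fun i => ?_
    fin_cases i
    · exact norm_le_pi_norm (W a) 1
    · exact norm_le_pi_norm (W a) 2
  have hWpos : ∀ a, ‖W a‖ ≠ 0 := fun a => (zero_lt_one.trans_le (hW1 a)).ne'
  let w : (Fin 2 → ℂ) → Fin 3 → ℂ := fun a => ((‖W a‖ : ℂ)⁻¹) • W a
  have hnorm : ∀ a, ‖w a‖ = 1 := fun a => by
    simp only [w, norm_smul, norm_inv, Complex.norm_real, norm_norm]
    exact inv_mul_cancel₀ (hWpos a)
  have hw0 : ∀ a, w a ≠ 0 := fun a h => by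
    have := hnorm a
    rw [h, norm_zero] at this
    exact zero_ne_one this
  obtain ⟨x, hx, hlim⟩ := (isCompact_sphere (0 : Fin 3 → ℂ) 1).ultrafilter_le_nhds (𝒰.map w)
    (by
      rw [le_principal_iff, Ultrafilter.coe_map, Filter.mem_map]
      exact Filter.univ_mem' fun a => by simp [hnorm a])
  have hx0 : x ≠ 0 := by
    rintro rfl
    simp at hx
  have hlim' : Tendsto w 𝒰 (𝓝 x) := hlim
  have hz : x 0 = 0 := by
    have h1 : Tendsto (fun a => w a 0) 𝒰 (𝓝 (x 0)) := (tendsto_pi_nhds.1 hlim') 0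
    have h2 : Tendsto (fun a => ‖W a‖) 𝒰 atTop := by
      refine tendsto_atTop_mono hW2 ?_
      exact (tendsto_norm_cocompact_atTop (E := Fin 2 → ℂ)).mono_left (h𝒰.trans inf_le_left)
    have h3 : Tendsto (fun a => w a 0) 𝒰 (𝓝 0) := by
      rw [tendsto_zero_iff_norm_tendsto_zero]
      refine (tendsto_inv_atTop_zero.comp h2).congr fun a => ?_
      simp [w, W]
    exact tendsto_nhds_unique h1 h3
  refine ⟨Projectivization.mk ℂ x hx0, ?_, ?_⟩
  · have h1 : Tendsto (fun a => (⟨w a, hw0 a⟩ : {w : Fin 3 → ℂ // w ≠ 0})) 𝒰 (𝓝 ⟨x, hx0⟩) :=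
      tendsto_subtype_rng.2 hlim'
    have h2 := (continuous_projectivization_mk.tendsto ⟨x, hx0⟩).comp h1
    refine mem_closure_of_tendsto h2 ?_
    have h3 : S ∈ (𝒰 : Filter (Fin 2 → ℂ)) := le_principal_iff.1 (h𝒰.trans inf_le_right)
    filter_upwards [h3] with a ha
    refine ⟨a, ha, ?_⟩
    have h4 : (‖W a‖ : ℂ)⁻¹ ≠ 0 := inv_ne_zero (by exact_mod_cast hWpos a)
    exact ((mk_eq_affineChart_iff (hw0 a)).2 ⟨mul_ne_zero h4 one_ne_zero, by simp [w, W],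
      by simp [w, W]⟩).symm
  · rw [mk_mem_range_affineChart_iff]
    exact fun h => h hz

/-- Openness of the quotient map lifts the closure to `ℂ³`, where limits are taken coordinatewise.
-/
theorem exists_mem_closure_of_mem_pointsAtInfinity {S : Set (Fin 2 → ℂ)} {q : ComplexProjectivePlane}
    (hq : q ∈ pointsAtInfinity S) : ∃ (w : Fin 3 → ℂ) (hw : w ≠ 0),
      q = Projectivization.mk ℂ w hw ∧ w 0 = 0 ∧
      w ∈ closure {z : Fin 3 → ℂ | z 0 ≠ 0 ∧ ![z 1 / z 0, z 2 / z 0] ∈ S} := by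
  obtain ⟨hcl, hran⟩ := hq
  obtain ⟨w, hw, rfl⟩ : ∃ (w : Fin 3 → ℂ) (hw : w ≠ 0), q = Projectivization.mk ℂ w hw :=
    ⟨q.rep, q.rep_nonzero, q.mk_rep.symm⟩
  rw [mk_mem_range_affineChart_iff, not_not] at hran
  refine ⟨w, hw, rfl, hran, ?_⟩
  have h1 := isOpenMap_projectivization_mk.preimage_closure_subset_closure_preimage
    (show (⟨w, hw⟩ : {w : Fin 3 → ℂ // w ≠ 0}) ∈ Projectivization.mk' ℂ ⁻¹' closure (affineChart '' S)
      from hcl)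
  rw [closure_subtype] at h1
  refine closure_mono ?_ h1
  rintro _ ⟨⟨z, hz⟩, ⟨a, ha, haz⟩, rfl⟩
  obtain ⟨h2, h3, h4⟩ := (mk_eq_affineChart_iff hz).1 haz.symm
  refine ⟨h2, ?_⟩
  convert ha using 1
  ext i
  fin_cases i
  · simp [h3, h2]
  · simp [h4, h2]

/-- In homogeneous coordinates `z₁^e z₀^d = ρ z₂^d z₀^e` with `ρ → c`. Cancel the smaller power of
`z₀` and let `z₀ → 0`: what remains is `[0 : 1 : 0]` if `e < d`, `[0 : 0 : 1]` if `d < e`, and `[0 :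
c : 1]` if `d = e`, where coprimality forces `d = e = 1`. -/
theorem existsUnique_pointsAtInfinity {S : Set (Fin 2 → ℂ)} {d e : ℕ} {c : ℂ} (hc : c ≠ 0)
    (hd : d ≠ 0) (he : e ≠ 0) (hde : Nat.Coprime d e)
    (hS : ¬ Bornology.IsBounded S)
    (hlim : Tendsto (fun a : Fin 2 → ℂ => a 0 ^ e / a 1 ^ d) (cocompact (Fin 2 → ℂ) ⊓ 𝓟 S)
      (𝓝 c)) : ∃! p, p ∈ pointsAtInfinity S := by
  have hlimit : ∀ w : Fin 3 → ℂ, w ≠ 0 → w 0 = 0 →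
      w ∈ closure {z : Fin 3 → ℂ | z 0 ≠ 0 ∧ ![z 1 / z 0, z 2 / z 0] ∈ S} →
      (e < d → w 2 = 0) ∧ (d < e → w 1 = 0) ∧ (d = e → w 1 = c * w 2) := by
    intro w hw hw0 hcl
    set T := {z : Fin 3 → ℂ | z 0 ≠ 0 ∧ ![z 1 / z 0, z 2 / z 0] ∈ S} with hT
    have hNB : (𝓝[T] w).NeBot := mem_closure_iff_nhdsWithin_neBot.1 hcl
    have hproj : ∀ i, Tendsto (fun z : Fin 3 → ℂ => z i) (𝓝[T] w) (𝓝 (w i)) := fun i =>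
      ((continuous_apply i).tendsto w).mono_left nhdsWithin_le_nhds
    have hinv : Tendsto (fun z : Fin 3 → ℂ => ‖z 0‖⁻¹) (𝓝[T] w) atTop := by
      refine tendsto_inv_nhdsGT_zero.comp (tendsto_nhdsWithin_iff.2 ⟨?_, ?_⟩)
      · have := (hproj 0).norm
        rwa [hw0, norm_zero] at this
      · filter_upwards [self_mem_nhdsWithin] with z hz
        exact norm_pos_iff.2 hz.1
    have hmap : Tendsto (fun z : Fin 3 → ℂ => ![z 1 / z 0, z 2 / z 0]) (𝓝[T] w)
        (cocompact (Fin 2 → ℂ) ⊓ 𝓟 S) := by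
      refine tendsto_inf.2 ⟨?_, ?_⟩
      · rw [← Metric.cobounded_eq_cocompact, ← tendsto_norm_atTop_iff_cobounded]
        obtain ⟨i, hi⟩ : ∃ i, w i ≠ 0 := by
          by_contra! hall
          exact hw (funext hall)
        have h1 : Tendsto (fun z : Fin 3 → ℂ => ‖z i‖ * ‖z 0‖⁻¹) (𝓝[T] w) atTop :=
          (hproj i).norm.pos_mul_atTop (norm_pos_iff.2 hi) hinv
        refine tendsto_atTop_mono (fun z => ?_) (f := fun z : Fin 3 → ℂ => ‖z i‖ * ‖z 0‖⁻¹) h1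
        have h2 := norm_le_pi_norm ![z 1 / z 0, z 2 / z 0]
        fin_cases i
        · exact absurd hw0 hi
        · simpa [div_eq_mul_inv] using h2 0
        · simpa [div_eq_mul_inv] using h2 1
      · rw [tendsto_principal]
        filter_upwards [self_mem_nhdsWithin] with z hz using hz.2
    have hρ := hlim.comp hmap
    set ρ : (Fin 3 → ℂ) → ℂ := fun z => (z 1 / z 0) ^ e / (z 2 / z 0) ^ d with hρdef
    have hρ' : Tendsto ρ (𝓝[T] w) (𝓝 c) := hρ
    have hrel : ∀ᶠ z in 𝓝[T] w, z 1 ^ e * z 0 ^ d = ρ z * z 2 ^ d * z 0 ^ e := by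
      filter_upwards [self_mem_nhdsWithin, hρ'.eventually_ne hc] with z hz hz'
      -- At `z 2 = 0` division by zero makes `ρ` zero, which is excluded near `c ≠ 0`.
      have h2 : z 2 ≠ 0 := by
        intro h
        apply hz'
        simp [hρdef, h, hd]
      have h0 : z 0 ≠ 0 := hz.1
      simp only [hρdef, div_pow]
      field_simp
    have hne : ∀ᶠ z in 𝓝[T] w, z 0 ≠ 0 := by
      filter_upwards [self_mem_nhdsWithin] with z hz using hz.1
    refine ⟨fun hlt => ?_, fun hlt => ?_, fun heq => ?_⟩
    · have h1 : Tendsto (fun z : Fin 3 → ℂ => z 1 ^ e * z 0 ^ (d - e)) (𝓝[T] w)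
          (𝓝 (w 1 ^ e * w 0 ^ (d - e))) := ((hproj 1).pow e).mul ((hproj 0).pow (d - e))
      have h2 : Tendsto (fun z : Fin 3 → ℂ => ρ z * z 2 ^ d) (𝓝[T] w) (𝓝 (c * w 2 ^ d)) :=
        hρ'.mul ((hproj 2).pow d)
      have h3 : w 1 ^ e * w 0 ^ (d - e) = c * w 2 ^ d := by
        refine tendsto_nhds_unique h1 (h2.congr' ?_)
        filter_upwards [hrel, hne] with z hz hz0
        apply mul_right_cancel₀ (pow_ne_zero e hz0)
        rw [← hz, mul_assoc, ← pow_add, Nat.sub_add_cancel hlt.le]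
      rw [hw0, zero_pow (by omega), mul_zero] at h3
      exact pow_eq_zero_iff hd |>.1 ((mul_eq_zero.1 h3.symm).resolve_left hc)
    · have h1 : Tendsto (fun z : Fin 3 → ℂ => z 1 ^ e) (𝓝[T] w) (𝓝 (w 1 ^ e)) := (hproj 1).pow e
      have h2 : Tendsto (fun z : Fin 3 → ℂ => ρ z * z 2 ^ d * z 0 ^ (e - d)) (𝓝[T] w)
          (𝓝 (c * w 2 ^ d * w 0 ^ (e - d))) :=
        (hρ'.mul ((hproj 2).pow d)).mul ((hproj 0).pow (e - d))
      have h3 : w 1 ^ e = c * w 2 ^ d * w 0 ^ (e - d) := by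
        refine tendsto_nhds_unique h1 (h2.congr' ?_)
        filter_upwards [hrel, hne] with z hz hz0
        apply mul_right_cancel₀ (pow_ne_zero d hz0)
        rw [hz, mul_assoc, ← pow_add, Nat.sub_add_cancel hlt.le]
      rw [hw0, zero_pow (by omega), mul_zero] at h3
      exact pow_eq_zero_iff he |>.1 h3
    · subst heq
      have hd1 : d = 1 := by simpa using hde
      subst hd1
      refine tendsto_nhds_unique (hproj 1) ((hρ'.mul (hproj 2)).congr' ?_)
      filter_upwards [hrel, hne] with z hz hz0
      apply mul_right_cancel₀ hz0
      simpa using hz.symm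
  obtain ⟨p, hp⟩ := pointsAtInfinity_nonempty hS
  refine ⟨p, hp, fun q hq => ?_⟩
  obtain ⟨w, hw, rfl, hw0, hwcl⟩ := exists_mem_closure_of_mem_pointsAtInfinity hp
  obtain ⟨z, hz, rfl, hz0, hzcl⟩ := exists_mem_closure_of_mem_pointsAtInfinity hq
  obtain ⟨hw1, hw2, hw3⟩ := hlimit w hw hw0 hwcl
  obtain ⟨hz1, hz2, hz3⟩ := hlimit z hz hz0 hzcl
  rw [Projectivization.mk_eq_mk_iff']
  have hne : ∀ {x : Fin 3 → ℂ}, x ≠ 0 → x 0 = 0 → x 1 = 0 → x 2 ≠ 0 := by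
    intro x hx h0 h1 h2
    apply hx
    ext i
    fin_cases i
    · exact h0
    · exact h1
    · exact h2
  rcases lt_trichotomy d e with h | h | h
  · have h2 := hne hw hw0 (hw2 h)
    refine ⟨z 2 / w 2, ?_⟩
    ext i
    fin_cases i
    · simp [hw0, hz0]
    · simp [hw2 h, hz2 h]
    · simp [h2]
  · have h2 : w 2 ≠ 0 := by
      intro h2
      exact hne hw hw0 (by rw [hw3 h, h2, mul_zero]) h2
    refine ⟨z 2 / w 2, ?_⟩
    ext i
    fin_cases i
    · simp [hw0, hz0]
    · simp only [Pi.smul_apply, smul_eq_mul, Fin.mk_one, hw3 h, hz3 h]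
      field_simp
    · simp [h2]
  · have h1 : w 1 ≠ 0 := fun h1 => hne hw hw0 h1 (hw1 h)
    refine ⟨z 1 / w 1, ?_⟩
    ext i
    fin_cases i
    · simp [hw0, hz0]
    · simp [h1]
    · simp [hw1 h, hz1 h]

/-! ### Branches at infinity -/

theorem AnalyticAt.exists_pow_eq {g : ℂ → ℂ} {z : ℂ} (hg : AnalyticAt ℂ g z) (hz : g z ≠ 0) {m : ℕ}
    (hm : m ≠ 0) : ∃ ρ : ℂ → ℂ, AnalyticAt ℂ ρ z ∧ ∀ t, ρ t ^ m = g t := by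
  obtain ⟨r, hr⟩ := IsAlgClosed.exists_pow_nat_eq (g z) (Nat.pos_of_ne_zero hm)
  refine ⟨fun t => r * (g t / g z) ^ ((m : ℂ)⁻¹), analyticAt_const.mul
    ((hg.div analyticAt_const hz).cpow analyticAt_const ?_), fun t => ?_⟩
  · rw [Pi.div_apply, div_self hz]
    exact Complex.one_mem_slitPlane
  · rw [mul_pow, hr, Complex.cpow_nat_inv_pow _ hm, mul_div_cancel₀ _ hz]

/-- Write `v = t ^ (-m) g` with `g 0 ≠ 0` and choose an analytic `ρ` with `ρ ^ m = g`; then `τ = t /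
ρ`. -/
theorem MeromorphicAt.exists_coordinate {v : ℂ → ℂ} (hv : MeromorphicAt v 0)
    (hlim : Tendsto v (𝓝[≠] 0) (Bornology.cobounded ℂ)) :
    ∃ (m : ℕ) (τ : ℂ → ℂ), 0 < m ∧ meromorphicOrderAt v 0 = ((-m : ℤ) : WithTop ℤ) ∧
      AnalyticAt ℂ τ 0 ∧ τ 0 = 0 ∧ deriv τ 0 ≠ 0 ∧ ∀ᶠ t in 𝓝[≠] 0, v t = (τ t)⁻¹ ^ m := by
  have hneg := (tendsto_cobounded_iff_meromorphicOrderAt_neg hv).1 hlim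
  obtain ⟨k, hk⟩ : ∃ k : ℤ, meromorphicOrderAt v 0 = k :=
    ⟨_, (WithTop.coe_untop₀_of_ne_top (hneg.trans_le le_top).ne).symm⟩
  have hk0 : k < 0 := by
    rw [hk] at hneg
    exact_mod_cast hneg
  obtain ⟨m, rfl⟩ : ∃ m : ℕ, k = -m := ⟨k.natAbs, by omega⟩
  have hm : m ≠ 0 := by omega
  obtain ⟨g, hg, hg0, hgv⟩ := (meromorphicOrderAt_eq_int_iff hv).1 hk
  obtain ⟨ρ, hρ, hρg⟩ := hg.exists_pow_eq hg0 hm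
  have hρ0 : ρ 0 ≠ 0 := by
    intro h
    rw [← hρg, h, zero_pow hm] at hg0
    exact hg0 rfl
  have hτ : AnalyticAt ℂ (fun t => t * (ρ t)⁻¹) 0 := analyticAt_id.mul (hρ.inv hρ0)
  refine ⟨m, fun t => t * (ρ t)⁻¹, Nat.pos_of_ne_zero hm, hk, hτ, zero_mul _, ?_, ?_⟩
  · have h1 := (hasDerivAt_id (0 : ℂ)).mul (hρ.inv hρ0).differentiableAt.hasDerivAt
    have h2 : deriv (fun t => t * (ρ t)⁻¹) 0 = (ρ 0)⁻¹ := by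
      refine h1.deriv.trans ?_
      simp
    rw [h2]
    exact inv_ne_zero hρ0
  · filter_upwards [hgv] with t ht
    rw [ht, sub_zero, smul_eq_mul, mul_inv, inv_inv, mul_pow, hρg, zpow_neg, zpow_natCast, inv_pow]

/-- Composed with the local inverse of `τ`, `u` is meromorphic in `τ` of the same order; the
expansion is its Laurent series. -/
theorem MeromorphicAt.exists_expansion {u τ : ℂ → ℂ} {k : ℤ} (hu : MeromorphicAt u 0)
    (hk : meromorphicOrderAt u 0 = k) (hτ : AnalyticAt ℂ τ 0) (hτ0 : τ 0 = 0)
    (hτ' : deriv τ 0 ≠ 0) :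
    ∃ (H : ℂ → ℂ) (a : ℕ → ℂ), AnalyticAt ℂ H 0 ∧ H 0 = a 0 ∧
      ∀ᶠ t in 𝓝[≠] 0, u t = (τ t)⁻¹ ^ (-k) * H (τ t) ∧
        HasSum (fun i : ℕ => a i * (τ t)⁻¹ ^ (-k - i)) (u t) := by
  let r := hτ.hasStrictDerivAt.localInverse _ _ _ hτ'
  have hr : ∀ᶠ t in 𝓝 0, r (τ t) = t := HasStrictDerivAt.eventually_left_inverse ..
  have heq : (u ∘ r) ∘ τ =ᶠ[𝓝[≠] 0] u := by
    filter_upwards [nhdsWithin_le_nhds hr] with t ht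
    simp only [Function.comp_apply, ht]
  have hU : MeromorphicAt (u ∘ r) 0 := by
    rw [← hτ0, ← meromorphicAt_comp_iff_of_deriv_ne_zero hτ hτ']
    exact hu.congr heq.symm
  have hUk : meromorphicOrderAt (u ∘ r) 0 = k := by
    have := meromorphicOrderAt_comp_of_deriv_ne_zero (f := u ∘ r) hτ hτ'
    rw [hτ0, meromorphicOrderAt_congr heq, hk] at this
    exact this.symm
  obtain ⟨H, hH, -, hHU⟩ := (meromorphicOrderAt_eq_int_iff hU).1 hUk
  obtain ⟨p, hp⟩ := hH
  have hτne : Tendsto τ (𝓝[≠] 0) (𝓝[≠] 0) := by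
    have := hτ.hasStrictDerivAt.hasDerivAt.tendsto_nhdsNE hτ'
    rwa [hτ0] at this
  refine ⟨H, p.coeff, hp.analyticAt, ?_, ?_⟩
  · exact (hp.coeff_zero _).symm
  · filter_upwards [hτne.eventually hHU, heq, hτne.eventually self_mem_nhdsWithin,
      hτne.eventually (nhdsWithin_le_nhds (hasFPowerSeriesAt_iff.1 hp))] with t h1 h2 h3 h4
    have hτt : τ t ≠ 0 := h3
    have h5 : u t = τ t ^ k * H (τ t) := by
      rw [← h2]
      simpa using h1
    refine ⟨by rw [h5, inv_zpow, zpow_neg, inv_inv], ?_⟩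
    rw [zero_add] at h4
    rw [h5]
    have hterm : (fun i : ℕ => p.coeff i * (τ t)⁻¹ ^ (-k - i)) =
        fun i => τ t ^ k * τ t ^ i • p.coeff i := by
      funext i
      rw [inv_zpow, ← zpow_neg, neg_sub, sub_neg_eq_add, add_comm, zpow_add₀ hτt, zpow_natCast,
        smul_eq_mul]
      ring
    rw [hterm]
    exact h4.mul_left (τ t ^ k)

/-- Where `v` is bounded, so is `u^e`, as the ratio is bounded near infinity; hence `v` itself must
go to infinity. -/
theorem tendsto_snd_cobounded {S : Set (Fin 2 → ℂ)} {d e : ℕ} {c : ℂ} (hc : c ≠ 0)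
    (hd : d ≠ 0) (he : e ≠ 0)
    (hlim : Tendsto (fun a : Fin 2 → ℂ => a 0 ^ e / a 1 ^ d) (cocompact (Fin 2 → ℂ) ⊓ 𝓟 S)
      (𝓝 c)) :
    Tendsto (fun a : Fin 2 → ℂ => a 1) (cocompact (Fin 2 → ℂ) ⊓ 𝓟 S) (Bornology.cobounded ℂ) := by
  rw [← tendsto_norm_atTop_iff_cobounded, tendsto_atTop]
  intro b
  set D := max (max b 1) ((‖c‖ + 1) * (max b 1) ^ d) with hD
  have hb1 : (1 : ℝ) ≤ max b 1 := le_max_right _ _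
  have hnorm : ∀ᶠ a in cocompact (Fin 2 → ℂ) ⊓ 𝓟 S, D < ‖a‖ :=
    ((tendsto_norm_cocompact_atTop (E := Fin 2 → ℂ)).mono_left inf_le_left).eventually_gt_atTop D
  filter_upwards [hnorm, hlim.norm.eventually_lt_const (lt_add_one ‖c‖),
    hlim.eventually_ne hc] with a ha hratio hne
  by_contra! hab
  have h1 : a 1 ≠ 0 := fun h => hne (by simp [h, hd])
  have h1b : ‖a 1‖ ≤ max b 1 := hab.le.trans (le_max_left _ _)
  have h0 : ‖a 0‖ ^ e ≤ D := by
    rw [norm_div, norm_pow, norm_pow, div_lt_iff₀ (pow_pos (norm_pos_iff.2 h1) d)] at hratio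
    exact (hratio.le.trans (by gcongr)).trans (le_max_right _ _)
  refine ha.not_ge ((pi_norm_le_iff_of_nonneg
    ((zero_le_one.trans hb1).trans (le_max_left _ _))).2 fun i => ?_)
  fin_cases i
  · rcases le_total ‖a 0‖ 1 with h | h
    · exact (h.trans hb1).trans (le_max_left _ _)
    · exact (le_self_pow₀ h he).trans h0
  · exact h1b.trans (le_max_left _ _)

/-- Along the branch `u^e / v^d` has a nonzero limit, so its meromorphic order is zero, which fixes
`n / m`. The powers of `τ` then cancel and the ratio is `H(τ) ^ e`, whose limit is `a 0 ^ e`. -/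
theorem IsBranchAtInfinity.exists_newtonPuiseuxExpansion {S : Set (Fin 2 → ℂ)} {d e : ℕ} {c : ℂ}
    {γ : ℂ → Fin 2 → ℂ} (hγ : IsBranchAtInfinity S γ) (hc : c ≠ 0) (hd : d ≠ 0) (he : e ≠ 0)
    (hlim : Tendsto (fun a : Fin 2 → ℂ => a 0 ^ e / a 1 ^ d) (cocompact (Fin 2 → ℂ) ⊓ 𝓟 S)
      (𝓝 c)) :
    ∃ (m : ℕ) (n : ℤ) (a : ℕ → ℂ), HasNewtonPuiseuxExpansion γ m n a ∧
      (n : ℚ) / (m : ℚ) = (d : ℚ) / (e : ℚ) ∧ a 0 ^ e = c := by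
  obtain ⟨hmer, hmem, -, hcocompact⟩ := hγ
  have hγS : Tendsto γ (𝓝[≠] 0) (cocompact (Fin 2 → ℂ) ⊓ 𝓟 S) :=
    tendsto_inf.2 ⟨hcocompact, tendsto_principal.2 hmem⟩
  have hratio : Tendsto (fun t => γ t 0 ^ e / γ t 1 ^ d) (𝓝[≠] 0) (𝓝 c) := hlim.comp hγS
  obtain ⟨m, τ, hm, hord, hτ, hτ0, hτ', hv⟩ := (hmer 1).exists_coordinate
    ((tendsto_snd_cobounded hc hd he hlim).comp hγS)
  obtain ⟨k, hk⟩ : ∃ k : ℤ, meromorphicOrderAt (fun t => γ t 0) 0 = k := by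
    refine ⟨_, (WithTop.coe_untop₀_of_ne_top ?_).symm⟩
    rw [meromorphicOrderAt_ne_top_iff_eventually_ne_zero (hmer 0)]
    filter_upwards [hratio.eventually_ne hc] with t ht h0
    exact ht (by rw [h0, zero_pow he, zero_div])
  obtain ⟨H, a, hH, hHa, hu⟩ := (hmer 0).exists_expansion hk hτ hτ0 hτ'
  have hkm : (e : ℤ) * -k = d * m := by
    have h1 := (tendsto_ne_zero_iff_meromorphicOrderAt_eq_zero
      (((hmer 0).pow e).div ((hmer 1).pow d))).1 ⟨c, hc, hratio⟩
    rw [meromorphicOrderAt_div ((hmer 0).pow e) ((hmer 1).pow d), meromorphicOrderAt_pow (hmer 0),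
      meromorphicOrderAt_pow (hmer 1), hk, hord] at h1
    have h2 : (e : ℤ) * k - d * -m = 0 := by exact_mod_cast h1
    linarith
  refine ⟨m, -k, a, ⟨hm, τ, hτ, hτ0, hτ', ?_⟩, ?_, ?_⟩
  · filter_upwards [hv, hu] with t h1 h2 using ⟨h1, h2.2⟩
  · rw [div_eq_div_iff (by exact_mod_cast hm.ne') (by exact_mod_cast he)]
    rw [mul_comm]
    exact_mod_cast hkm
  · have hτne : Tendsto τ (𝓝[≠] 0) (𝓝[≠] 0) := by
      have := hτ.hasStrictDerivAt.hasDerivAt.tendsto_nhdsNE hτ'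
      rwa [hτ0] at this
    have h1 : Tendsto (fun t => H (τ t) ^ e) (𝓝[≠] 0) (𝓝 (H 0 ^ e)) :=
      (hH.continuousAt.tendsto.comp (hτne.mono_right nhdsWithin_le_nhds)).pow e
    rw [← hHa]
    refine tendsto_nhds_unique h1 (hratio.congr' ?_)
    filter_upwards [hv, hu, hτne.eventually self_mem_nhdsWithin] with t h2 h3 h4
    have hτt : (τ t)⁻¹ ≠ 0 := inv_ne_zero h4
    have h5 : ((τ t)⁻¹ ^ (-k)) ^ e = ((τ t)⁻¹ ^ m) ^ d := by
      rw [← zpow_natCast, ← zpow_mul, mul_comm, hkm, ← pow_mul, ← zpow_natCast, Nat.cast_mul,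
        mul_comm]
    rw [h2, h3.1, mul_pow, h5, mul_div_cancel_left₀ _ (pow_ne_zero _ (pow_ne_zero _ hτt))]

/-! ### Positivity of the degrees and the final assembly -/

theorem jacobianDet_eq_zero_of_totalDegree_fst {P Q : MvPolynomial (Fin 2) ℂ}
    (h : P.totalDegree = 0) : jacobianDet P Q = 0 := by
  rw [MvPolynomial.totalDegree_eq_zero_iff_eq_C.1 h]
  simp [jacobianDet]

theorem jacobianDet_eq_zero_of_totalDegree_snd {P Q : MvPolynomial (Fin 2) ℂ}
    (h : Q.totalDegree = 0) : jacobianDet P Q = 0 := by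
  rw [MvPolynomial.totalDegree_eq_zero_iff_eq_C.1 h]
  simp [jacobianDet]

end

theorem corollary2 (P Q : MvPolynomial (Fin 2) ℂ) (j A B : ℂ) (K d e : ℕ)
    (hj : j ≠ 0) (hJ : jacobianDet P Q = MvPolynomial.C j)
    (hde : Nat.Coprime d e)
    (hP : P.totalDegree = K * d) (hQ : Q.totalDegree = K * e)
    (hA : P.coeff (Finsupp.single 1 (K * d)) = A) (hA0 : A ≠ 0)
    (hB : Q.coeff (Finsupp.single 1 (K * e)) = B) (hB0 : B ≠ 0)
    (hne : (nonProperValueSet (polyMap P Q)).Nonempty) :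
    IsPlaneCurve (nonProperValueSet (polyMap P Q)) ∧
    (∃! p, p ∈ pointsAtInfinity (nonProperValueSet (polyMap P Q))) ∧
    ∀ γ, IsBranchAtInfinity (nonProperValueSet (polyMap P Q)) γ →
      ∃ (m : ℕ) (n : ℤ) (a : ℕ → ℂ), HasNewtonPuiseuxExpansion γ m n a ∧
        (n : ℚ) / (m : ℚ) = (d : ℚ) / (e : ℚ) ∧
        a 0 ^ e = A ^ e / B ^ d := by
  have hJ0 : jacobianDet P Q ≠ 0 := by
    rw [hJ]
    exact MvPolynomial.C_ne_zero.2 hj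
  have hM : K * d ≠ 0 := fun h => hJ0 (jacobianDet_eq_zero_of_totalDegree_fst (hP.trans h))
  have hN : K * e ≠ 0 := fun h => hJ0 (jacobianDet_eq_zero_of_totalDegree_snd (hQ.trans h))
  have hd : d ≠ 0 := right_ne_zero_of_mul hM
  have he : e ≠ 0 := right_ne_zero_of_mul hN
  have hc : A ^ e / B ^ d ≠ 0 := div_ne_zero (pow_ne_zero e hA0) (pow_ne_zero d hB0)
  have h : IsKellerPair P Q (K * d) (K * e) A B j :=
    ⟨hJ, hj, hM, hN, hP.le, hQ.le, hA, hB, hA0, hB0⟩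
  have hlim := h.tendsto_ratio hd he (by ring)
  have hset := h.nonProperValueSet_eq
  set R := (eliminant P Q (K * d) (K * e)).leadingCoeff with hR
  have hR0 : R ≠ 0 := Polynomial.leadingCoeff_ne_zero.2 h.eliminant_ne_zero
  -- A nonzero constant has no zeros, so the non-proper value set would be empty.
  have hRdeg : R.totalDegree ≠ 0 := by
    intro h0
    obtain ⟨a, ha⟩ := hne
    rw [hset] at ha
    obtain hRC := MvPolynomial.totalDegree_eq_zero_iff_eq_C.1 h0
    apply hR0
    have ha' : MvPolynomial.eval a R = 0 := ha
    rw [hRC, MvPolynomial.eval_C] at ha'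
    rw [hRC, ha', map_zero]
  refine ⟨⟨R, hRdeg, hset⟩, existsUnique_pointsAtInfinity hc hd he hde ?_ hlim,
    fun γ hγ => hγ.exists_newtonPuiseuxExpansion hc hd he hlim⟩
  rw [hset]
  exact not_isBounded_zeroSet hRdeg
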